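/- **Setting.** Let $(X,\mathcal A)$ be a measurable space, let $H$ be a separable (real) reproducing kernel Hilbert space on $X$ with bounded, measurable kernel $k$, and let $P$ be a probability measure on $X\times\mathbb R$ with $\int y^2\,dP(x,y)<\infty$. Let $\nu:=P_X$ be the marginal of $P$ on $X$, let $P(\cdot\mid x)$ be a regular conditional probability of $P$, and let $f_P^*(x):=\int y\,P(dy\mid x)$ be the conditional mean function. Write $[f]_\nu$ for the $\nu$-equivalence class of $f$, let $I_\nu:H\to L_2(\nu)$, $f\mapsto[f]_\nu$, and consider the integral operators $T_\nu=I_\nu I_\nu^*$ on $L_2(\nu)$ and $I_\nu^*I_\nu$ on $H$. Fix a spectral decomposition: a family $(\mu_i)_{i\in I}$ of positive, summable eigenvalues and $(e_i)_{i\in I}\subseteq H$ such that $(\mu_i^{1/2}e_i)_i$ is orthonormal in $H$, $([e_i]_\nu)_i$ is orthonormal in $L_2(\nu)$, $I_\nu^*I_\nu=\sum_i\mu_i\langle\cdot,\mu_i^{1/2}e_i\rangle_H\,\mu_i^{1/2}e_i$ and $T_\nu=\sum_i\mu_i\langle\cdot,[e_i]_\nu\rangle_{L_2(\nu)}[e_i]_\nu$.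 For $s\ge 0$ the power space is $[H]_\nu^s:=\{\sum_i a_i\mu_i^{s/2}[e_i]_\nu:(a_i)\in\ell_2(I)\}$ with norm $\|\sum_i a_i\mu_i^{s/2}[e_i]_\nu\|_{[H]_\nu^s}:=\|(a_i)\|_{\ell_2(I)}$. Let $\|k_\nu^s\|_\infty\in[0,\infty]$ be the smallest $C$ with $\sum_i\mu_i^s e_i(x)^2\le C^2$ for $\nu$-almost all $x$. The effective dimension is $\mathcal N(\lambda):=\sum_i\frac{\mu_i}{\mu_i+\lambda}$ for $\lambda>0$. Let $f_{P,\lambda}$ be the minimizer over $f\in H$ of $\lambda\|f\|_H^2+\int(y-f(x))^2\,dP(x,y)$, and for $D=((x_1,y_1),\dots,(x_n,y_n))$ let $f_{D,\lambda}$ be the minimizer over $f\in H$ of $\lambda\|f\|_H^2+\frac1n\sum_{i=1}^n(y_i-f(x_i))^2$. **Theorem (Estimation Error – Oracle Inequality).** Let $0\le\alpha,\gamma\le1$ and assume 1. (source condition) $f_P^*\in L_\infty(\nu)\cap[H]_\nu^\gamma$, 2. (embedding property) $\|k_\nu^\alpha\|_\infty<\infty$, 3. (moment condition) there are constants $L,R>0$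 with $\int|y-f_P^*(x)|^m\,P(dy\mid x)\le\frac12\,m!\,L^2R^{m-2}$ for $\nu$-almost all $x\in X$ and all integers $m\ge2$. For $\lambda>0$ and $\tau\ge1$ set $$g_\lambda:=\max\bigl\{256\,\tau^2\|k_\nu^\alpha\|_\infty^2\lambda^{-\alpha}\mathcal N(\lambda),\ 16\,\tau\|k_\nu^\alpha\|_\infty^2\lambda^{-\alpha},\ \tau\bigr\},$$ $$L_\lambda:=\max\{L,\|f_P^*-[f_{P,\lambda}]_\nu\|_{L_\infty(\nu)}\},\qquad R_\lambda:=\max\{R,\|f_P^*-[f_{P,\lambda}]_\nu\|_{L_\infty(\nu)}\}.$$ Then for all $\tau\ge1$, $\lambda>0$ and all integers $n\ge g_\lambda$, $$\bigl\|[f_{D,\lambda}-f_{P,\lambda}]_\nu\bigr\|_{[H]_\nu^\gamma}^2\le128\,\frac{\tau^2}{n\lambda^\gamma}\Bigl(5\,\mathcal N(\lambda)L_\lambda^2+\|k_\nu^\alpha\|_\infty^2\frac{R_\lambda^2}{n\lambda^\alpha}\Bigr)$$ holds with $P^n$-probability at least $1-4e^{-\tau}$ with respect to $D$; that is, the set of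 those $D\in(X\times\mathbb R)^n$ for which the inequality fails has outer $P^n$-measure at most $4e^{-\tau}$. -/

import Mathlib

open MeasureTheory Filter Topology
open scoped ENNReal InnerProductSpace

noncomputable section

namespace KernelRegression

universe u v

section RKHSBasics

variable {X : Type u} (H : Type v) [NormedAddCommGroup H] [InnerProductSpace ℝ H]
  [CompleteSpace H] [RKHS ℝ H X ℝ]

/-- The scalar kernel `k(x, x')` of a real RKHS `H` over `X`. -/
def kern (x x' : X) : ℝ := RKHS.kernel H x x' 1

/-- The canonical feature `k(·, x) ∈ H`. -/
def feature (x : X) : H := RKHS.kerFun H x 1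

/-- The kernel of `H` is measurable on `X × X` and bounded. -/
structure BoundedMeasurableKernel [MeasurableSpace X] : Prop where
  measurable : Measurable fun p : X × X => kern H p.1 p.2
  bounded : ∃ C : ℝ, ∀ x x' : X, |kern H x x'| ≤ C

variable {H}

theorem inner_feature (x : X) (f : H) : ⟪feature H x, f⟫_ℝ = f x := by
  simp [feature]

theorem kern_self (x : X) : kern H x x = ‖feature H x‖ ^ 2 := by
  have h : kern H x x = (feature H x : H) x := by
    simp [kern, feature, RKHS.kerFun_apply]
  rw [h, ← inner_feature, real_inner_self_eq_norm_sq]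

theorem abs_coe_le {C : ℝ} (hC : ∀ x : X, ‖feature H x‖ ≤ C) (f : H) (x : X) :
    ‖f x‖ ≤ C * ‖f‖ := by
  rw [← inner_feature]
  exact (norm_inner_le_norm _ _).trans (by gcongr; exact hC x)

variable [MeasurableSpace X]

theorem BoundedMeasurableKernel.exists_norm_feature_le (hk : BoundedMeasurableKernel H) :
    ∃ C : ℝ, 0 ≤ C ∧ ∀ x : X, ‖feature H x‖ ≤ C := by
  obtain ⟨C, hC⟩ := hk.bounded
  refine ⟨√C, Real.sqrt_nonneg _, fun x => Real.le_sqrt_of_sq_le ?_⟩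
  rw [← kern_self]
  exact (le_abs_self _).trans (hC x x)

/-- Every element of an RKHS with measurable kernel is a measurable function. -/
theorem BoundedMeasurableKernel.measurable_coe (hk : BoundedMeasurableKernel H) (f : H) :
    Measurable (f : X → ℝ) := by
  have hmem : f ∈ (Submodule.span ℝ {RKHS.kerFun H x v | (x : X) (v : ℝ)}).topologicalClosure := by
    rw [RKHS.kerFun_dense]; trivial
  have hmem' : f ∈ closure
      ((Submodule.span ℝ {RKHS.kerFun H x v | (x : X) (v : ℝ)} : Submodule ℝ H) : Set H) := hmem
  obtain ⟨g, hg, hlim⟩ := mem_closure_iff_seq_limit.1 hmem'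
  refine measurable_of_tendsto_metrizable (f := fun n => (g n : X → ℝ)) (fun n => ?_)
    (tendsto_pi_nhds.2 fun x => ((RKHS.continuous_eval x).tendsto f).comp hlim)
  refine Submodule.span_induction (p := fun (h : H) _ => Measurable (h : X → ℝ)) ?_ ?_ ?_ ?_ (hg n)
  · rintro _ ⟨x, v, rfl⟩
    have : (RKHS.kerFun H x v : X → ℝ) = fun y => v * kern H y x := by
      funext y
      rw [RKHS.kerFun_apply, kern, ← smul_eq_mul, ← map_smul]; simp
    rw [this]
    exact (hk.measurable.comp (measurable_id.prodMk measurable_const)).const_mul v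
  · rw [RKHS.coe_zero]; exact measurable_const
  · intro a b _ _ ha hb; simpa using ha.add hb
  · intro c a _ ha; simpa using ha.const_smul c

theorem BoundedMeasurableKernel.memLp_coe (hk : BoundedMeasurableKernel H) (p : ℝ≥0∞)
    (ν : Measure X) [IsFiniteMeasure ν] (f : H) : MemLp (f : X → ℝ) p ν := by
  obtain ⟨C, -, hC⟩ := hk.exists_norm_feature_le
  exact MemLp.of_bound (hk.measurable_coe f).aestronglyMeasurable (C * ‖f‖)
    (Eventually.of_forall (abs_coe_le hC f))

/-- The embedding `I_ν : H → L₂(ν)`, `f ↦ [f]_ν` (not necessarily injective). -/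
def embL2 (hk : BoundedMeasurableKernel H) (ν : Measure X) [IsFiniteMeasure ν] :
    H →L[ℝ] Lp ℝ 2 ν :=
  LinearMap.mkContinuousOfExistsBound
    { toFun := fun f => (hk.memLp_coe 2 ν f).toLp f
      map_add' := fun f g => by
        rw [← MemLp.toLp_add]; congr 1; simp
      map_smul' := fun c f => by
        rw [RingHom.id_apply, ← MemLp.toLp_const_smul]; congr 1; simp }
    (by
      obtain ⟨C, hC0, hC⟩ := hk.exists_norm_feature_le
      refine ⟨(measureUnivNNReal ν) ^ ((2 : ℝ≥0∞).toReal)⁻¹ * C, fun f => ?_⟩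
      rw [mul_assoc]
      refine Lp.norm_le_of_ae_bound (mul_nonneg hC0 (norm_nonneg f)) ?_
      filter_upwards [(hk.memLp_coe 2 ν f).coeFn_toLp] with x hx
      simp only [LinearMap.coe_mk, AddHom.coe_mk]
      rw [hx]
      exact abs_coe_le hC f x)

theorem coeFn_embL2 (hk : BoundedMeasurableKernel H) (ν : Measure X) [IsFiniteMeasure ν] (f : H) :
    embL2 hk ν f =ᵐ[ν] (f : X → ℝ) :=
  (hk.memLp_coe 2 ν f).coeFn_toLp

/-- The integral operator `T_ν = I_ν I_ν^* : L₂(ν) → L₂(ν)`. -/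
def opL2 (hk : BoundedMeasurableKernel H) (ν : Measure X) [IsFiniteMeasure ν] :
    Lp ℝ 2 ν →L[ℝ] Lp ℝ 2 ν :=
  embL2 hk ν ∘L (embL2 hk ν).adjoint

/-- The integral operator `I_ν^* I_ν : H → H`. -/
def opH (hk : BoundedMeasurableKernel H) (ν : Measure X) [IsFiniteMeasure ν] : H →L[ℝ] H :=
  (embL2 hk ν).adjoint ∘L embL2 hk ν

/-- A spectral decomposition of the integral operators: positive summable eigenvalues `μ i` and
functions `e i ∈ H` such that `(√(μ i) e i)` is orthonormal in `H`, `([e i]_ν)` is orthonormal in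
`L₂(ν)`, and both operators are diagonal. Nothing below depends on how the eigenvalues are ordered,
so the index set is an arbitrary type. See `exists_spectralSystem` for existence. -/
structure SpectralSystem (hk : BoundedMeasurableKernel H) (ν : Measure X) [IsFiniteMeasure ν]
    (ι : Type*) where
  eigval : ι → ℝ
  eigfun : ι → H
  eigval_pos : ∀ i, 0 < eigval i
  summable_eigval : Summable eigval
  orthonormal_H : Orthonormal ℝ fun i => √(eigval i) • eigfun i
  orthonormal_L2 : Orthonormal ℝ fun i => embL2 hk ν (eigfun i)
  hasSum_opH : ∀ h : H, HasSum
    (fun i => (eigval i * ⟪√(eigval i) • eigfun i, h⟫_ℝ) • (√(eigval i) • eigfun i)) (opH hk ν h)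
  hasSum_opL2 : ∀ g : Lp ℝ 2 ν, HasSum
    (fun i => (eigval i * ⟪embL2 hk ν (eigfun i), g⟫_ℝ) • embL2 hk ν (eigfun i)) (opL2 hk ν g)

namespace SpectralSystem

variable {hk : BoundedMeasurableKernel H} {ν : Measure X} [IsFiniteMeasure ν] {ι : Type*}
  (E : SpectralSystem hk ν ι)

/-- The series `∑ᵢ aᵢ μᵢ^(s/2) [eᵢ]_ν` converges to `g` in `L₂(ν)`. -/
def IsExpansion (s : ℝ) (a : lp (fun _ : ι => ℝ) 2) (g : Lp ℝ 2 ν) : Prop :=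
  HasSum (fun i => (a i * E.eigval i ^ (s / 2)) • embL2 hk ν (E.eigfun i)) g

/-- The `s`-power space `[H]_ν^s ⊆ L₂(ν)`. -/
def powerSpace (s : ℝ) : Set (Lp ℝ 2 ν) := {g | ∃ a, E.IsExpansion s a g}

/-- The `s`-power space norm: the `ℓ₂`-norm of the (unique) coefficient sequence of `g`, and `∞`
if `g` is not in the `s`-power space. -/
def powerNorm (s : ℝ) (g : Lp ℝ 2 ν) : ℝ≥0∞ :=
  ⨅ (a : lp (fun _ : ι => ℝ) 2) (_ : E.IsExpansion s a g), ENNReal.ofReal ‖a‖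

/-- `‖k_ν^s‖_{L_∞(ν)}`: the smallest `C ∈ [0, ∞]` with `∑ᵢ μᵢ^s eᵢ(x)² ≤ C²` for `ν`-almost all
`x`. -/
def kernelPowerNorm (s : ℝ) : ℝ≥0∞ :=
  sInf {C : ℝ≥0∞ | ∀ᵐ x ∂ν,
    ∑' i, ENNReal.ofReal (E.eigval i ^ s * (E.eigfun i x) ^ 2) ≤ C ^ 2}

/-- The effective dimension `N(lam) = ∑ᵢ μᵢ / (μᵢ + lam)`, for `lam > 0`. -/
def effDim (lam : ℝ) : ℝ := ∑' i, E.eigval i / (E.eigval i + lam)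

/-- The sample size bound `g_lam`, the maximum of `256 τ² ‖k_ν^α‖²_∞ lam^(-α) N(lam)`,
`16 τ ‖k_ν^α‖²_∞ lam^(-α)` and `τ`. -/
def sampleBound (α τ lam : ℝ) : ℝ :=
  max (max (256 * τ ^ 2 * (E.kernelPowerNorm α).toReal ^ 2 * lam ^ (-α) * E.effDim lam)
    (16 * τ * (E.kernelPowerNorm α).toReal ^ 2 * lam ^ (-α))) τ

end SpectralSystem

end RKHSBasics

section Existence

variable {X : Type u} {H : Type v} [NormedAddCommGroup H] [InnerProductSpace ℝ H]
  [CompleteSpace H] [RKHS ℝ H X ℝ] [MeasurableSpace X]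

/-- The embedding into `L₂(ν)` is Hilbert-Schmidt. -/
theorem summable_norm_embL2_sq (hk : BoundedMeasurableKernel H) (ν : Measure X) [IsFiniteMeasure ν]
    {ι : Type*} {w : ι → H} (hw : Orthonormal ℝ w) :
    Summable fun i => ‖embL2 hk ν (w i)‖ ^ 2 := by
  obtain ⟨C, hC0, hC⟩ := hk.exists_norm_feature_le
  refine summable_of_sum_le (c := C ^ 2 * ν.real Set.univ) (fun _ => sq_nonneg _) fun s => ?_
  have h1 : ∀ i, ‖embL2 hk ν (w i)‖ ^ 2 = ∫ x, (w i x) ^ 2 ∂ν := by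
    intro i
    rw [← real_inner_self_eq_norm_sq, L2.inner_def]
    refine integral_congr_ae ?_
    filter_upwards [coeFn_embL2 hk ν (w i)] with x hx
    rw [hx]; simp [sq]
  have hint : ∀ i, Integrable (fun x => (w i x) ^ 2) ν := fun i =>
    (hk.memLp_coe 2 ν (w i)).integrable_sq
  simp_rw [h1]
  rw [← integral_finsetSum _ fun i _ => hint i]
  calc ∫ x, ∑ i ∈ s, (w i x) ^ 2 ∂ν ≤ ∫ _, C ^ 2 ∂ν := by
        refine integral_mono (integrable_finsetSum _ fun i _ => hint i) (integrable_const _) ?_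
        intro x
        have := hw.sum_inner_products_le (feature H x) (s := s)
        have h2 : ∑ i ∈ s, (w i x) ^ 2 = ∑ i ∈ s, ‖⟪w i, feature H x⟫_ℝ‖ ^ 2 := by
          refine Finset.sum_congr rfl fun i _ => ?_
          rw [real_inner_comm, inner_feature]; simp
        simp only
        rw [h2]
        exact this.trans (pow_le_pow_left₀ (norm_nonneg _) (hC x) 2)
    _ = C ^ 2 * ν.real Set.univ := by simp [mul_comm]

theorem isCompactOperator_embL2 (hk : BoundedMeasurableKernel H) (ν : Measure X)
    [IsFiniteMeasure ν] : IsCompactOperator (embL2 hk ν) := by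
  obtain ⟨w, b, hb⟩ := exists_hilbertBasis ℝ H
  set I := embL2 hk ν
  let A : w → H →L[ℝ] Lp ℝ 2 ν := fun i => (innerSL ℝ (b i)).smulRight (I (b i))
  have hA : ∀ i x, A i x = ⟪b i, x⟫_ℝ • I (b i) := fun i x => by simp [A]
  have hHS : Summable fun i => ‖I (b i)‖ ^ 2 := summable_norm_embL2_sq hk ν b.orthonormal
  have hsum : Summable A := by
    rw [summable_iff_vanishing_norm]
    intro ε hε
    obtain ⟨s, hs⟩ := summable_iff_vanishing_norm.1 hHS ((ε / 2) ^ 2) (by positivity)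
    refine ⟨s, fun t ht => ?_⟩
    refine lt_of_le_of_lt ?_ (half_lt_self hε)
    refine ContinuousLinearMap.opNorm_le_bound _ (by positivity) fun x => ?_
    rw [sum_apply]
    calc ‖∑ i ∈ t, A i x‖ ≤ ∑ i ∈ t, ‖⟪b i, x⟫_ℝ‖ * ‖I (b i)‖ :=
          norm_sum_le_of_le _ fun i _ => by rw [hA, norm_smul]
      _ ≤ √(∑ i ∈ t, ‖⟪b i, x⟫_ℝ‖ ^ 2) * √(∑ i ∈ t, ‖I (b i)‖ ^ 2) :=
          Real.sum_mul_le_sqrt_mul_sqrt _ _ _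
      _ ≤ ‖x‖ * (ε / 2) := by
          gcongr
          · exact Real.sqrt_le_iff.2 ⟨norm_nonneg _, b.orthonormal.sum_inner_products_le x⟩
          · refine Real.sqrt_le_iff.2 ⟨by positivity, ?_⟩
            exact (le_abs_self _).trans (hs t ht).le
      _ = ε / 2 * ‖x‖ := mul_comm _ _
  obtain ⟨B, hB⟩ := hsum
  have hBI : B = I := by
    ext1 x
    have h1 : HasSum (fun i => A i x) (B x) :=
      hB.mapL (ContinuousLinearMap.apply ℝ (Lp ℝ 2 ν) x)
    have h2 : HasSum (fun i => A i x) (I x) := by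
      simpa [hA, b.repr_apply_apply] using (b.hasSum_repr x).mapL I
    exact h1.unique h2
  rw [← hBI]
  refine isCompactOperator_of_tendsto hB (Eventually.of_forall fun s => ?_)
  have hc : ∀ i, IsCompactOperator (A i) := fun i => by
    have h : IsCompactOperator (ContinuousLinearMap.toSpanSingleton ℝ (I (b i))) :=
      isCompactOperator_of_locallyCompactSpace_rng _
    exact (h.comp_clm (innerSL ℝ (b i)) :)
  classical
  induction s using Finset.induction_on with
  | empty => simpa using (isCompactOperator_zero : IsCompactOperator (0 : H → Lp ℝ 2 ν))
  | insert i s hi ih => rw [Finset.sum_insert hi]; exact (hc i).add ih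

theorem hasSum_subtype_of_eq_zero {α G : Type*} [AddCommMonoid G] [TopologicalSpace G]
    {p : α → Prop} (f : α → G) (g : G) (hf : ∀ i, ¬ p i → f i = 0) (hg : HasSum f g) :
    HasSum (fun i : {i // p i} => f i.1) g := by
  refine (hasSum_subtype_iff_of_support_subset (s := {i | p i}) ?_).2 hg
  intro i hi
  by_contra h
  exact hi (hf i h)

/-- Spectral theorem for the integral operators of a bounded measurable kernel. -/
theorem exists_spectralSystem (hk : BoundedMeasurableKernel H) (ν : Measure X)
    [IsFiniteMeasure ν] : ∃ ι : Type v, Nonempty (SpectralSystem hk ν ι) := by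
  set I := embL2 hk ν with hI
  set T := opH hk ν with hT
  have hTI : ∀ x y : H, ⟪x, T y⟫_ℝ = ⟪I x, I y⟫_ℝ := fun x y => by
    simp [hT, opH, ← hI, ContinuousLinearMap.adjoint_inner_right]
  have hTc : IsCompactOperator T := (isCompactOperator_embL2 hk ν).clm_comp (I.adjoint)
  have hTs : (T : H →ₗ[ℝ] H).IsSymmetric := fun x y => by
    simp only [ContinuousLinearMap.coe_coe]
    rw [real_inner_comm, hTI, hTI, real_inner_comm]
  let V : ℝ → Submodule ℝ H := fun m => Module.End.eigenspace (T : Module.End ℝ H) m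
  have hVmem : ∀ m (x : H), x ∈ V m ↔ T x = m • x := fun m x => by
    simp [V]
  have hVc : ∀ m, CompleteSpace (V m) := fun m => by
    have : IsClosed (V m : Set H) := by
      have h : (V m : Set H) = {x | T x = m • x} := by ext x; exact hVmem m x
      rw [h]
      exact isClosed_eq T.continuous (continuous_const_smul m)
    exact this.completeSpace_coe
  choose w b hb using fun m => exists_hilbertBasis ℝ (V m)
  let c : (Σ m, w m) → H := fun i => (b i.1 i.2 : H)
  have hTm : ∀ i, T (c i) = i.1 • c i := fun i => (hVmem _ _).1 (b i.1 i.2).2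
  have hc : Orthonormal ℝ c :=
    (hTs.orthogonalFamily_eigenspaces).orthonormal_sigma_orthonormal fun m => (b m).orthonormal
  have hbot : (Submodule.span ℝ (Set.range c))ᗮ = ⊥ := by
    rw [eq_bot_iff, ← ContinuousLinearMap.orthogonalComplement_iSup_eigenspaces_eq_bot hTc hTs]
    intro x hx
    have hx' : ∀ i, ⟪c i, x⟫_ℝ = 0 := fun i =>
      hx (c i) (Submodule.subset_span ⟨i, rfl⟩)
    rw [Submodule.mem_orthogonal']
    intro y hy
    refine Submodule.iSup_induction _ (motive := fun y => ⟪x, y⟫_ℝ = 0) hy ?_ (by simp) ?_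
    · intro m z hz
      have h1 := (((b m).hasSum_repr ⟨z, hz⟩).mapL (V m).subtypeL).mapL (innerSL ℝ x)
      have h2 : ∀ i, innerSL ℝ x ((V m).subtypeL ((b m).repr ⟨z, hz⟩ i • b m i)) = 0 := fun i => by
        have := hx' ⟨m, i⟩
        rw [real_inner_comm] at this
        simp only [map_smul, innerSL_apply_apply, Submodule.subtypeL_apply]
        exact mul_eq_zero_of_right _ this
      simp only [h2] at h1
      simpa using h1.unique hasSum_zero
    · intro y z hy hz
      rw [inner_add_right, hy, hz, add_zero]
  let B : HilbertBasis (Σ m, w m) ℝ H := HilbertBasis.mkOfOrthogonalEqBot hc hbot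
  have hB : ∀ i, B i = c i := fun i =>
    congrFun (HilbertBasis.coe_mkOfOrthogonalEqBot hc hbot) i
  have hin : ∀ i j, ⟪I (c i), I (c j)⟫_ℝ = j.1 * ⟪c i, c j⟫_ℝ := fun i j => by
    rw [← hTI, hTm, real_inner_smul_right]
  have hnorm : ∀ i, ‖I (c i)‖ ^ 2 = i.1 := fun i => by
    rw [← real_inner_self_eq_norm_sq, hin, real_inner_self_eq_norm_sq, hc.1 i]; simp
  have hnn : ∀ i : (Σ m, w m), 0 ≤ i.1 := fun i => by rw [← hnorm i]; positivity
  let J := {i : (Σ m, w m) // 0 < i.1}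
  let e : J → H := fun i => (√i.1.1)⁻¹ • c i.1
  have hs0 : ∀ i : J, √i.1.1 ≠ 0 := fun i => (Real.sqrt_pos.2 i.2).ne'
  have he : ∀ i : J, √i.1.1 • e i = c i.1 := fun i => smul_inv_smul₀ (hs0 i) _
  have hcJ : Orthonormal ℝ fun i : J => c i.1 := hc.comp _ Subtype.val_injective
  have hzero : ∀ i : (Σ m, w m), ¬ 0 < i.1 → i.1 = 0 ∧ I (c i) = 0 := fun i hi => by
    have h0 : i.1 = 0 := le_antisymm (not_lt.1 hi) (hnn i)
    refine ⟨h0, ?_⟩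
    have := hnorm i
    rw [h0] at this
    exact norm_eq_zero.1 (pow_eq_zero_iff two_ne_zero |>.1 this)
  have k1 : Summable fun i : J => i.1.1 := by
    simpa only [← hI, hnorm] using! (summable_norm_embL2_sq hk ν hcJ)
  have k2 : Orthonormal ℝ fun i : J => √i.1.1 • e i := by simpa only [he] using hcJ
  have k3 : Orthonormal ℝ fun i : J => I (e i) := by
    classical
    rw [orthonormal_iff_ite]
    intro i j
    simp only [e, map_smul, real_inner_smul_left, real_inner_smul_right, hin]
    rw [orthonormal_iff_ite.1 hcJ i j]
    split_ifs with hij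
    · subst hij
      have h2 := hs0 i
      field_simp
      rw [Real.sq_sqrt i.2.le]
    · simp
  have k4 : ∀ h : H, HasSum
      (fun i : J => (i.1.1 * ⟪√i.1.1 • e i, h⟫_ℝ) • (√i.1.1 • e i)) (T h) := by
    intro h
    simp only [he]
    refine hasSum_subtype_of_eq_zero (fun i => (i.1 * ⟪c i, h⟫_ℝ) • c i) _ (fun i hi => by simp [(hzero i hi).1]) ?_
    have := (B.hasSum_repr h).mapL T
    simp only [B.repr_apply_apply, hB, map_smul, hTm] at this
    simpa only [smul_smul, mul_comm] using this
  have k5 : ∀ g : Lp ℝ 2 ν, HasSum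
      (fun i : J => (i.1.1 * ⟪I (e i), g⟫_ℝ) • I (e i)) (opL2 hk ν g) := by
    intro g
    have h1 : ∀ i : J, (i.1.1 * ⟪I (e i), g⟫_ℝ) • I (e i) = ⟪I (c i.1), g⟫_ℝ • I (c i.1) := by
      intro i
      simp only [e, map_smul, real_inner_smul_left, smul_smul]
      congr 1
      have h2 := hs0 i
      field_simp
      rw [Real.sq_sqrt i.2.le]
    simp only [h1]
    refine hasSum_subtype_of_eq_zero (fun i => ⟪I (c i), g⟫_ℝ • I (c i)) _ (fun i hi => by simp [(hzero i hi).2]) ?_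
    have := (B.hasSum_repr (I.adjoint g)).mapL I
    simpa only [B.repr_apply_apply, hB, map_smul, ContinuousLinearMap.adjoint_inner_right,
      opL2, ← hI, ContinuousLinearMap.comp_apply] using this
  exact ⟨J, ⟨⟨fun i => i.1.1, e, fun i => i.2, k1, k2, k3, k4, k5⟩⟩⟩

end Existence

section Regression

variable {X : Type u} [MeasurableSpace X]

/-- A version `x ↦ ∫ y P(dy | x)` of the conditional mean function of `P`. -/
def condMean (P : Measure (X × ℝ)) [IsFiniteMeasure P] (x : X) : ℝ :=
  ∫ y, y ∂(P.condKernel x)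

/-- The Bernstein moment condition with constants `L, R`: for `P_X`-almost all `x` and all `m ≥ 2`,
`∫ |y - f_P^*(x)|^m P(dy | x) ≤ (1/2) m! L² R^(m-2)`. -/
def MomentCondition (P : Measure (X × ℝ)) [IsFiniteMeasure P] (L R : ℝ) : Prop :=
  ∀ᵐ x ∂P.fst, ∀ m : ℕ, 2 ≤ m →
    ∫⁻ y, ENNReal.ofReal (|y - condMean P x| ^ m) ∂(P.condKernel x) ≤
      ENNReal.ofReal (1 / 2 * (m.factorial : ℝ) * L ^ 2 * R ^ (m - 2))

variable (H : Type v) [NormedAddCommGroup H] [InnerProductSpace ℝ H] [RKHS ℝ H X ℝ]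

/-- The LS-SVM solution `f_{P,lam}`: the minimizer over `H` of
`lam ‖f‖² + ∫ (y - f(x))² dP(x, y)`. -/
def svmPop (P : Measure (X × ℝ)) (lam : ℝ) : H :=
  Classical.epsilon fun f : H => IsMinOn
    (fun f : H => lam * ‖f‖ ^ 2 + ∫ p, (p.2 - f p.1) ^ 2 ∂P) Set.univ f

/-- The LS-SVM predictor `f_{D,lam}` for the data `D = ((x₁, y₁), …, (xₙ, yₙ))`: the minimizer
over `H` of `lam ‖f‖² + (1/n) ∑ᵢ (yᵢ - f(xᵢ))²`. -/
def svmEmp {n : ℕ} (D : Fin n → X × ℝ) (lam : ℝ) : H :=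
  Classical.epsilon fun f : H => IsMinOn
    (fun f : H => lam * ‖f‖ ^ 2 + 1 / (n : ℝ) * ∑ i, ((D i).2 - f (D i).1) ^ 2) Set.univ f

/-- `‖f_P^* - [f_{P,lam}]‖_{L_∞(P_X)}`. -/
def approxErrorSup (P : Measure (X × ℝ)) [IsFiniteMeasure P] (lam : ℝ) : ℝ :=
  (eLpNorm (fun x => condMean P x - svmPop H P lam x) ∞ P.fst).toReal

end Regression

end KernelRegression

end

noncomputable section

/-! Let `h` be the difference of the empirical and the population solution. In eigencoordinates, put
the weight `√(μᵢ + lam)` on `h` and its inverse on the feature: with `u = regCoef h` and `φ =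
regFeature`, almost every `x` satisfies `h(x) = ⟪u, φ(x)⟫`. Subtracting the two normal equations
gives `lam ‖h‖² + ‖I_ν h‖² = ⟪u, Z⟫ - ⟪u ⊗ u, W⟫`, where `Z` (`residualDev`) is the empirical minus
the population mean of `(y - f_{P,lam}(x)) φ(x)`, and `W` (`covarianceDev`) is the same for `φ(x) ⊗
φ(x)`. The left side dominates `‖u‖²`, so `‖W‖ ≤ 1/2` forces `‖u‖ ≤ 2 ‖Z‖` (`norm_regCoef_le`), and
the squared power norm of `[h]` is at most `lam^(-γ) ‖u‖²` (`powerNorm_embL2_sq_le`).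

What remains is probability. Both `Z` and `W` are centred averages of independent vectors in a
Hilbert space, since measuring `W` in the Hilbert–Schmidt norm turns the covariance into a vector.
One Bernstein inequality (`BernsteinMoments.measure_pi_le`) thus serves twice, each time with
failure probability `2 e^(-τ)`. Its moments come from two facts: `‖φ‖²` has mean `N(lam)`
(`lintegral_norm_regFeature_sq`) and is almost surely at most `‖k_ν^α‖²_∞ lam^(-α)`
(`ae_norm_regFeature_sq_le`). The sample size bound is what makes `‖W‖ ≤ 1/2` likely.

The Bernstein inequality rests on `cosh ‖·‖`: adding an independent centred vector `d` multiplies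
its expectation by at most `E[e^‖d‖ - ‖d‖]`, with no dependence on dimension. -/

namespace KernelRegression

/-! ### Bernstein's inequality in a Hilbert space. -/

section Bernstein

variable {E : Type*} [NormedAddCommGroup E]

/-- The function `w ↦ cosh √w` is convex on `[0, ∞)`. -/
theorem cosh_le_of_sq_eq {θ a b c : ℝ} (h0 : 0 ≤ θ) (h1 : θ ≤ 1)
    (hc : c ^ 2 = θ * a ^ 2 + (1 - θ) * b ^ 2) :
    Real.cosh c ≤ θ * Real.cosh a + (1 - θ) * Real.cosh b := by
  refine hasSum_le (fun k => ?_) (Real.hasSum_cosh c)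
    (((Real.hasSum_cosh a).mul_left θ).add ((Real.hasSum_cosh b).mul_left (1 - θ)))
  -- The power series of `cosh` are compared term by term: `c^(2k)` is the `k`-th power of a convex
  -- combination of `a²` and `b²`.
  have h := (convexOn_pow (𝕜 := ℝ) k).2 (Set.mem_Ici.2 (sq_nonneg a)) (Set.mem_Ici.2 (sq_nonneg b))
    h0 (sub_nonneg.2 h1) (by ring)
  simp only [smul_eq_mul] at h
  rw [← hc] at h
  simp only [← pow_mul] at h
  rw [← mul_div_assoc, ← mul_div_assoc, ← add_div]
  gcongr

/-- The right side exceeds the left by exactly `(sinh r - r) e^(-s)`. The sign of `s` is free, so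
that `-s` can be inserted as well. -/
theorem cosh_add_le_of_nonneg (s : ℝ) {r : ℝ} (hr : 0 ≤ r) :
    Real.cosh (s + r) ≤ Real.cosh s * (Real.exp r - r) + r * Real.sinh s := by
  have h1 : r ≤ Real.sinh r := Real.self_le_sinh_iff.2 hr
  have h2 : 0 < Real.exp (-s) := Real.exp_pos _
  rw [← Real.cosh_sub_sinh] at h2
  rw [Real.cosh_add, ← Real.cosh_add_sinh r]
  nlinarith

/-- A second order expansion of `cosh ‖·‖` in an inner product space. -/
theorem cosh_norm_add_le [InnerProductSpace ℝ E] (x d : E) :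
    Real.cosh ‖x + d‖ ≤ Real.cosh ‖x‖ * (Real.exp ‖d‖ - ‖d‖) +
      Real.sinh ‖x‖ / ‖x‖ * ⟪x, d⟫_ℝ := by
  rcases eq_or_ne x 0 with rfl | hx
  -- Here `sinh ‖x‖ / ‖x‖` is `0 / 0 = 0`, which is harmless because the inner product vanishes too.
  · simpa using cosh_add_le_of_nonneg 0 (norm_nonneg d)
  rcases eq_or_ne d 0 with rfl | hd
  · simp
  have hs : 0 < ‖x‖ := norm_pos_iff.2 hx
  have hr : 0 < ‖d‖ := norm_pos_iff.2 hd
  have hq := abs_le.1 (abs_real_inner_le_norm x d)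
  have hn := norm_add_sq_real x d
  set s := ‖x‖
  set r := ‖d‖
  set q := ⟪x, d⟫_ℝ
  have hsr : 0 < 2 * (s * r) := by positivity
  -- With `s`, `r` fixed, `‖x + d‖²` is affine in `q` and runs from `(s - r)²` to `(s + r)²`; `θ` is
  -- the position of `q` in `[-sr, sr]`. The `sinh` terms then combine with weight `2θ - 1 = q /
  -- (sr)`.
  have key := cosh_le_of_sq_eq (θ := (q + s * r) / (2 * (s * r))) (a := s + r) (b := s + -r)
    (c := ‖x + d‖) (div_nonneg (by linarith) hsr.le) ((div_le_one hsr).2 (by linarith))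
    (by rw [hn]; field_simp; ring)
  have ha := cosh_add_le_of_nonneg s hr.le
  have hb := cosh_add_le_of_nonneg (-s) hr.le
  rw [← Real.cosh_neg (-s + r), neg_add, neg_neg, Real.cosh_neg, Real.sinh_neg] at hb
  have hθ0 : 0 ≤ (q + s * r) / (2 * (s * r)) := div_nonneg (by linarith) hsr.le
  have hθ1 : 0 ≤ 1 - (q + s * r) / (2 * (s * r)) :=
    sub_nonneg.2 ((div_le_one hsr).2 (by linarith))
  refine key.trans ((add_le_add (mul_le_mul_of_nonneg_left ha hθ0)
    (mul_le_mul_of_nonneg_left hb hθ1)).trans (le_of_eq ?_))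
  field_simp
  ring

variable {Ω : Type*} [MeasurableSpace Ω] {P : Measure Ω}

theorem integrable_of_exp_norm {d : Ω → E} (hd : StronglyMeasurable d)
    (hexp : Integrable (fun ω => Real.exp ‖d ω‖) P) : Integrable d P :=
  hexp.mono' hd.aestronglyMeasurable
    (Eventually.of_forall fun ω => by linarith [Real.add_one_le_exp ‖d ω‖])

/-- The first order term of `cosh_norm_add_le` is linear in `d` and integrates to zero. -/
theorem lintegral_cosh_norm_add_le [InnerProductSpace ℝ E] [CompleteSpace E]
    [IsProbabilityMeasure P] {d : Ω → E} (hd : StronglyMeasurable d)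
    (hexp : Integrable (fun ω => Real.exp ‖d ω‖) P) (hmean : ∫ ω, d ω ∂P = 0) (x : E) :
    ∫⁻ ω, ENNReal.ofReal (Real.cosh ‖x + d ω‖) ∂P ≤
      ENNReal.ofReal (Real.cosh ‖x‖ * ∫ ω, (Real.exp ‖d ω‖ - ‖d ω‖) ∂P) := by
  have hint := integrable_of_exp_norm hd hexp
  have h1 : Integrable (fun ω => Real.cosh ‖x‖ * (Real.exp ‖d ω‖ - ‖d ω‖)) P :=
    (hexp.sub hint.norm).const_mul _
  have h2 : Integrable (fun ω => Real.sinh ‖x‖ / ‖x‖ * ⟪x, d ω⟫_ℝ) P :=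
    (hint.const_inner x).const_mul _
  have h3 : ∫ ω, (Real.cosh ‖x‖ * (Real.exp ‖d ω‖ - ‖d ω‖) +
      Real.sinh ‖x‖ / ‖x‖ * ⟪x, d ω⟫_ℝ) ∂P =
      Real.cosh ‖x‖ * ∫ ω, (Real.exp ‖d ω‖ - ‖d ω‖) ∂P := by
    rw [integral_add h1 h2, integral_const_mul, integral_const_mul, integral_inner hint, hmean]
    simp
  have h4 : Integrable (fun ω => Real.cosh ‖x‖ * (Real.exp ‖d ω‖ - ‖d ω‖) +
      Real.sinh ‖x‖ / ‖x‖ * ⟪x, d ω⟫_ℝ) P := h1.add h2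
  rw [← h3, ofReal_integral_eq_lintegral_ofReal h4]
  · exact lintegral_mono fun ω => ENNReal.ofReal_le_ofReal (cosh_norm_add_le x (d ω))
  · exact Eventually.of_forall fun ω => (Real.cosh_pos _).le.trans (cosh_norm_add_le x (d ω))

theorem stronglyMeasurable_sum_pi {d : Ω → E} (hd : StronglyMeasurable d) (n : ℕ) :
    StronglyMeasurable fun D : Fin n → Ω => ∑ i, d (D i) :=
  Finset.stronglyMeasurable_fun_sum _ fun i _ => hd.comp_measurable (measurable_pi_apply i)

theorem measurable_ofReal_cosh_norm {α : Type*} [MeasurableSpace α] {f : α → E}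
    (hf : StronglyMeasurable f) : Measurable fun a => ENNReal.ofReal (Real.cosh ‖f a‖) :=
  (Real.measurable_cosh.comp hf.norm.measurable).ennreal_ofReal

/-- The starting point `x` is arbitrary so that induction can absorb one summand into it and
integrate the others first. -/
theorem lintegral_cosh_norm_add_sum_le [InnerProductSpace ℝ E] [CompleteSpace E]
    [IsProbabilityMeasure P] {d : Ω → E} (hd : StronglyMeasurable d)
    (hexp : Integrable (fun ω => Real.exp ‖d ω‖) P) (hmean : ∫ ω, d ω ∂P = 0) (n : ℕ) (x : E) :
    ∫⁻ D : Fin n → Ω, ENNReal.ofReal (Real.cosh ‖x + ∑ i, d (D i)‖) ∂Measure.pi (fun _ => P) ≤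
      ENNReal.ofReal (Real.cosh ‖x‖ * (∫ ω, (Real.exp ‖d ω‖ - ‖d ω‖) ∂P) ^ n) := by
  set K := ∫ ω, (Real.exp ‖d ω‖ - ‖d ω‖) ∂P
  have hK : 0 ≤ K := integral_nonneg fun ω => by
    simp only [Pi.zero_apply]; linarith [Real.add_one_le_exp ‖d ω‖]
  induction n generalizing x with
  | zero => simp
  | succ n ih =>
    have hmp := measurePreserving_piFinSuccAbove (fun _ : Fin (n + 1) => P) 0
    have hm : Measurable fun z : Ω × (Fin n → Ω) =>
        ENNReal.ofReal (Real.cosh ‖x + d z.1 + ∑ i, d (z.2 i)‖) :=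
      measurable_ofReal_cosh_norm ((stronglyMeasurable_const.add
        (hd.comp_measurable measurable_fst)).add
          ((stronglyMeasurable_sum_pi hd n).comp_measurable measurable_snd))
    calc ∫⁻ D : Fin (n + 1) → Ω, ENNReal.ofReal (Real.cosh ‖x + ∑ i, d (D i)‖)
          ∂Measure.pi (fun _ => P)
        = ∫⁻ z : Ω × (Fin n → Ω), ENNReal.ofReal (Real.cosh ‖x + d z.1 + ∑ i, d (z.2 i)‖)
            ∂(P.prod (Measure.pi fun _ => P)) := by
          rw [← hmp.lintegral_comp hm]
          refine lintegral_congr fun D => ?_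
          simp [Fin.sum_univ_succ, add_assoc, MeasurableEquiv.piFinSuccAbove, Fin.tail]
      _ = ∫⁻ ω, ∫⁻ D : Fin n → Ω, ENNReal.ofReal (Real.cosh ‖x + d ω + ∑ i, d (D i)‖)
            ∂Measure.pi (fun _ => P) ∂P := lintegral_prod _ hm.aemeasurable
      _ ≤ ∫⁻ ω, ENNReal.ofReal (Real.cosh ‖x + d ω‖) * ENNReal.ofReal (K ^ n) ∂P := by
          refine lintegral_mono fun ω => (ih (x + d ω)).trans (le_of_eq ?_)
          rw [ENNReal.ofReal_mul (Real.cosh_pos _).le]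
      _ = (∫⁻ ω, ENNReal.ofReal (Real.cosh ‖x + d ω‖) ∂P) * ENNReal.ofReal (K ^ n) :=
          lintegral_mul_const' _ _ ENNReal.ofReal_ne_top
      _ ≤ ENNReal.ofReal (Real.cosh ‖x‖ * K) * ENNReal.ofReal (K ^ n) := by
          gcongr
          exact lintegral_cosh_norm_add_le hd hexp hmean x
      _ = ENNReal.ofReal (Real.cosh ‖x‖ * K ^ (n + 1)) := by
          rw [← ENNReal.ofReal_mul (mul_nonneg (Real.cosh_pos _).le hK)]
          congr 1; ring

/-- An exponential tail bound for sums of independent centred random vectors. -/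
theorem measure_pi_lt_norm_sum_le [InnerProductSpace ℝ E] [CompleteSpace E]
    [IsProbabilityMeasure P] {d : Ω → E} (hd : StronglyMeasurable d)
    (hexp : Integrable (fun ω => Real.exp ‖d ω‖) P) (hmean : ∫ ω, d ω ∂P = 0) (n : ℕ) (t : ℝ) :
    Measure.pi (fun _ : Fin n => P) {D | t < ‖∑ i, d (D i)‖} ≤
      ENNReal.ofReal (2 * Real.exp
        (-t + n * ∫ ω, (Real.exp ‖d ω‖ - 1 - ‖d ω‖) ∂P)) := by
  have hint := integrable_of_exp_norm hd hexp
  set v := ∫ ω, (Real.exp ‖d ω‖ - 1 - ‖d ω‖) ∂P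
  have hK : ∫ ω, (Real.exp ‖d ω‖ - ‖d ω‖) ∂P = v + 1 := by
    have h : ∀ ω, Real.exp ‖d ω‖ - ‖d ω‖ = (Real.exp ‖d ω‖ - 1 - ‖d ω‖) + 1 := fun ω => by ring
    simp_rw [h]
    have h1 : Integrable (fun ω => Real.exp ‖d ω‖ - 1 - ‖d ω‖) P :=
      (hexp.sub (integrable_const 1)).sub hint.norm
    rw [integral_add h1 (integrable_const 1)]
    simp [v]
  have hv : 0 ≤ v := integral_nonneg fun ω => by
    simp only [Pi.zero_apply]; linarith [Real.add_one_le_exp ‖d ω‖]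
  have key := lintegral_cosh_norm_add_sum_le hd hexp hmean n 0
  rw [hK] at key
  simp only [zero_add, norm_zero, Real.cosh_zero, one_mul] at key
  have hm := measurable_ofReal_cosh_norm (stronglyMeasurable_sum_pi hd n)
  have hsub : {D : Fin n → Ω | t < ‖∑ i, d (D i)‖} ⊆
      {D | ENNReal.ofReal (Real.exp t / 2) ≤ ENNReal.ofReal (Real.cosh ‖∑ i, d (D i)‖)} := by
    intro D hD
    refine ENNReal.ofReal_le_ofReal ?_
    rw [Real.cosh_eq]
    have := Real.exp_le_exp.2 (le_of_lt hD)
    have := Real.exp_pos (-‖∑ i, d (D i)‖)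
    linarith
  have hpos : 0 < Real.exp t / 2 := by positivity
  refine (measure_mono hsub).trans ((meas_ge_le_lintegral_div hm.aemeasurable
    (ENNReal.ofReal_pos.2 hpos).ne' ENNReal.ofReal_ne_top).trans ?_)
  refine (ENNReal.div_le_div_right key _).trans ?_
  rw [← ENNReal.ofReal_div_of_pos hpos]
  refine ENNReal.ofReal_le_ofReal ?_
  rw [div_le_iff₀ hpos]
  calc (v + 1) ^ n ≤ Real.exp v ^ n := pow_le_pow_left₀ (by linarith) (Real.add_one_le_exp v) n
    _ = Real.exp (-t + n * v) * Real.exp t := by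
        rw [← Real.exp_nat_mul, ← Real.exp_add]; congr 1; ring
    _ = 2 * Real.exp (-t + n * v) * (Real.exp t / 2) := by ring

/-- The Bernstein moment condition for a random vector. -/
def BernsteinMoments (P : Measure Ω) (ψ : Ω → E) (v B : ℝ) : Prop :=
  ∀ m : ℕ, 2 ≤ m → ∫⁻ ω, ENNReal.ofReal (‖ψ ω‖ ^ m) ∂P ≤
    ENNReal.ofReal (1 / 2 * (m.factorial : ℝ) * v * B ^ (m - 2))

theorem BernsteinMoments.integrable [IsProbabilityMeasure P] {ψ : Ω → E} {v B : ℝ} (h : BernsteinMoments P ψ v B)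
    (hψ : StronglyMeasurable ψ) : Integrable ψ P := by
  have h2 : Integrable (fun ω => ‖ψ ω‖ ^ 2) P := by
    refine ⟨(hψ.norm.pow 2).aestronglyMeasurable, ?_⟩
    rw [hasFiniteIntegral_iff_ofReal (Eventually.of_forall fun ω => sq_nonneg _)]
    exact (h 2 le_rfl).trans_lt ENNReal.ofReal_lt_top
  refine (h2.add (integrable_const (1 : ℝ))).mono' hψ.aestronglyMeasurable
    (Eventually.of_forall fun ω => ?_)
  simp only [Pi.add_apply]
  nlinarith [sq_nonneg (‖ψ ω‖ - 1), norm_nonneg (ψ ω)]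

theorem hasSum_exp_sub_one_sub (r : ℝ) :
    HasSum (fun m : ℕ => r ^ (m + 2) / ((m + 2).factorial : ℝ)) (Real.exp r - 1 - r) := by
  have h : HasSum (fun m : ℕ => r ^ m / (m.factorial : ℝ)) (Real.exp r) := by
    rw [Real.exp_eq_exp_ℝ]; exact NormedSpace.expSeries_div_hasSum_exp r
  have := (hasSum_nat_add_iff' 2).2 h
  simpa [Finset.sum_range_succ, sub_sub] using this

/-- In the exponential series the factorials cancel against those of the moment bounds, leaving a
geometric series of ratio `s B`. -/
theorem BernsteinMoments.lintegral_exp_le {ψ : Ω → E} {v B : ℝ} (h : BernsteinMoments P ψ v B)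
    (hψ : StronglyMeasurable ψ) (hv : 0 ≤ v) (hB : 0 ≤ B) {s : ℝ} (hs : 0 ≤ s) (hsB : s * B < 1) :
    ∫⁻ ω, ENNReal.ofReal (Real.exp (s * ‖ψ ω‖) - 1 - s * ‖ψ ω‖) ∂P ≤
      ENNReal.ofReal (s ^ 2 * v / (2 * (1 - s * B))) := by
  have hsB0 : 0 ≤ s * B := mul_nonneg hs hB
  have hpt : ∀ ω, ENNReal.ofReal (Real.exp (s * ‖ψ ω‖) - 1 - s * ‖ψ ω‖) =
      ∑' m : ℕ, ENNReal.ofReal (s ^ (m + 2) / ((m + 2).factorial : ℝ)) *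
        ENNReal.ofReal (‖ψ ω‖ ^ (m + 2)) := by
    intro ω
    have hS := hasSum_exp_sub_one_sub (s * ‖ψ ω‖)
    rw [← hS.tsum_eq, ENNReal.ofReal_tsum_of_nonneg (fun m => by positivity) hS.summable]
    refine tsum_congr fun m => ?_
    rw [← ENNReal.ofReal_mul (by positivity), mul_pow]
    congr 1; ring
  simp_rw [hpt]
  have hmeas : ∀ m : ℕ, Measurable fun ω => ENNReal.ofReal (‖ψ ω‖ ^ (m + 2)) := fun m =>
    (hψ.norm.measurable.pow_const _).ennreal_ofReal
  rw [lintegral_tsum fun m => ((hmeas m).const_mul _).aemeasurable]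
  have hgeo := (hasSum_geometric_of_lt_one hsB0 hsB).mul_left (s ^ 2 * v / 2)
  have hval : s ^ 2 * v / 2 * (1 - s * B)⁻¹ = s ^ 2 * v / (2 * (1 - s * B)) := by
    rw [div_mul_eq_div_div, div_eq_mul_inv _ (1 - s * B)]
  rw [← hval, ← hgeo.tsum_eq, ENNReal.ofReal_tsum_of_nonneg (fun m => by positivity) hgeo.summable]
  refine ENNReal.tsum_le_tsum fun m => ?_
  rw [lintegral_const_mul _ (hmeas m)]
  refine (mul_le_mul_right (h (m + 2) (by omega)) _).trans (le_of_eq ?_)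
  rw [← ENNReal.ofReal_mul (by positivity)]
  congr 1
  have : ((m + 2).factorial : ℝ) ≠ 0 := by positivity
  simp only [Nat.add_sub_cancel]
  field_simp
  ring

/-- The function `r ↦ e^r - 1 - r` increases on `[0, ∞)` and is convex, and `a + b` is the midpoint
of `2a` and `2b`. This is why centring costs a factor two in the scale. -/
theorem exp_sub_one_sub_le_of_le_add {r a b : ℝ} (hr : 0 ≤ r) (h : r ≤ a + b) :
    Real.exp r - 1 - r ≤
      ((Real.exp (2 * a) - 1 - 2 * a) + (Real.exp (2 * b) - 1 - 2 * b)) / 2 := by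
  have h1 : Real.exp r - r ≤ Real.exp (a + b) - (a + b) := by
    have := Real.add_one_le_exp (a + b - r)
    have h2 : Real.exp (a + b) = Real.exp r * Real.exp (a + b - r) := by
      rw [← Real.exp_add]; congr 1; ring
    have := Real.one_le_exp hr
    nlinarith
  have h2 : Real.exp (a + b) ≤ (Real.exp (2 * a) + Real.exp (2 * b)) / 2 := by
    have e1 : Real.exp (2 * a) = Real.exp a ^ 2 := by rw [← Real.exp_nat_mul]; norm_num
    have e2 : Real.exp (2 * b) = Real.exp b ^ 2 := by rw [← Real.exp_nat_mul]; norm_num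
    rw [e1, e2, Real.exp_add]
    nlinarith [sq_nonneg (Real.exp a - Real.exp b)]
  linarith

/-- The centred version of the exponential moment bound. -/
theorem BernsteinMoments.centered [NormedSpace ℝ E] [CompleteSpace E]
    [IsProbabilityMeasure P] {ψ : Ω → E} {v B : ℝ}
    (h : BernsteinMoments P ψ v B)
    (hψ : StronglyMeasurable ψ) (hv : 0 ≤ v) (hB : 0 ≤ B) {s : ℝ} (hs : 0 ≤ s) (hsB : s * B < 1) :
    Integrable (fun ω => Real.exp ‖(s / 2) • (ψ ω - ∫ ω, ψ ω ∂P)‖) P ∧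
    ∫ ω, (Real.exp ‖(s / 2) • (ψ ω - ∫ ω, ψ ω ∂P)‖ - 1 - ‖(s / 2) • (ψ ω - ∫ ω, ψ ω ∂P)‖) ∂P ≤
      s ^ 2 * v / (2 * (1 - s * B)) := by
  have hψi := h.integrable hψ
  set M := ∫ ω, ψ ω ∂P
  have hg0 : ∀ r : ℝ, 0 ≤ Real.exp r - 1 - r := fun r => by linarith [Real.add_one_le_exp r]
  have hgm : StronglyMeasurable fun ω => Real.exp (s * ‖ψ ω‖) - 1 - s * ‖ψ ω‖ :=
    ((Real.continuous_exp.comp_stronglyMeasurable (hψ.norm.const_mul s)).sub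
      stronglyMeasurable_const).sub (hψ.norm.const_mul s)
  have hle := h.lintegral_exp_le hψ hv hB hs hsB
  have hgi : Integrable (fun ω => Real.exp (s * ‖ψ ω‖) - 1 - s * ‖ψ ω‖) P := by
    refine ⟨hgm.aestronglyMeasurable, ?_⟩
    rw [hasFiniteIntegral_iff_ofReal (Eventually.of_forall fun ω => hg0 _)]
    exact hle.trans_lt ENNReal.ofReal_lt_top
  have hsi : Integrable (fun ω => s * ‖ψ ω‖) P := hψi.norm.const_mul s
  have hei : Integrable (fun ω => Real.exp (s * ‖ψ ω‖)) P := by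
    refine ((hgi.add hsi).add (integrable_const (1 : ℝ))).congr (Eventually.of_forall fun ω => ?_)
    simp only [Pi.add_apply]; ring
  have hgint : ∫ ω, (Real.exp (s * ‖ψ ω‖) - 1 - s * ‖ψ ω‖) ∂P ≤ s ^ 2 * v / (2 * (1 - s * B)) := by
    rw [integral_eq_lintegral_of_nonneg_ae (Eventually.of_forall fun ω => hg0 _)
      hgm.aestronglyMeasurable]
    refine ENNReal.toReal_le_of_le_ofReal ?_ hle
    exact div_nonneg (by positivity) (by linarith)
  -- Jensen's inequality: the mean contributes no more than `ψ` itself, so averaging the two gives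
  -- the uncentred bound back.
  have hM : Real.exp (s * ‖M‖) - 1 - s * ‖M‖ ≤
      ∫ ω, (Real.exp (s * ‖ψ ω‖) - 1 - s * ‖ψ ω‖) ∂P := by
    have h1 : Real.exp (∫ ω, s * ‖ψ ω‖ ∂P) ≤ ∫ ω, Real.exp (s * ‖ψ ω‖) ∂P :=
      convexOn_exp.map_integral_le Real.continuous_exp.continuousOn isClosed_univ
        (Eventually.of_forall fun _ => Set.mem_univ _) hsi hei
    have h2 : s * ‖M‖ ≤ ∫ ω, s * ‖ψ ω‖ ∂P := by
      rw [integral_const_mul]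
      exact mul_le_mul_of_nonneg_left (norm_integral_le_integral_norm _) hs
    have h0 : Integrable (fun ω => Real.exp (s * ‖ψ ω‖) - 1) P := hei.sub (integrable_const 1)
    rw [integral_sub h0 hsi, integral_sub hei (integrable_const 1)]
    have h3 := Real.add_one_le_exp (∫ ω, s * ‖ψ ω‖ ∂P - s * ‖M‖)
    have h4 : Real.exp (∫ ω, s * ‖ψ ω‖ ∂P) =
        Real.exp (s * ‖M‖) * Real.exp (∫ ω, s * ‖ψ ω‖ ∂P - s * ‖M‖) := by
      rw [← Real.exp_add]; congr 1; ring
    have h5 := Real.one_le_exp (mul_nonneg hs (norm_nonneg M))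
    simp only [integral_const, probReal_univ, smul_eq_mul, one_mul]
    nlinarith
  have hpt : ∀ ω, Real.exp ‖(s / 2) • (ψ ω - M)‖ - 1 - ‖(s / 2) • (ψ ω - M)‖ ≤
      ((Real.exp (s * ‖ψ ω‖) - 1 - s * ‖ψ ω‖) + (Real.exp (s * ‖M‖) - 1 - s * ‖M‖)) / 2 := by
    intro ω
    have h1 : ‖(s / 2) • (ψ ω - M)‖ ≤ s / 2 * ‖ψ ω‖ + s / 2 * ‖M‖ := by
      rw [norm_smul, Real.norm_of_nonneg (by positivity), ← mul_add]
      exact mul_le_mul_of_nonneg_left (norm_sub_le _ _) (by positivity)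
    have := exp_sub_one_sub_le_of_le_add (norm_nonneg _) h1
    rwa [show 2 * (s / 2 * ‖ψ ω‖) = s * ‖ψ ω‖ by ring,
      show 2 * (s / 2 * ‖M‖) = s * ‖M‖ by ring] at this
  have hdm : StronglyMeasurable fun ω => (s / 2) • (ψ ω - M) :=
    (hψ.sub stronglyMeasurable_const).const_smul _
  have hdi : Integrable (fun ω => (s / 2) • (ψ ω - M)) P :=
    (hψi.sub (integrable_const M)).smul (s / 2)
  have hdem : StronglyMeasurable fun ω => Real.exp ‖(s / 2) • (ψ ω - M)‖ :=
    Real.continuous_exp.comp_stronglyMeasurable hdm.norm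
  have hbi : Integrable (fun ω => ((Real.exp (s * ‖ψ ω‖) - 1 - s * ‖ψ ω‖) +
      (Real.exp (s * ‖M‖) - 1 - s * ‖M‖)) / 2) P :=
    (hgi.add (integrable_const _)).div_const 2
  have hgdi : Integrable (fun ω => Real.exp ‖(s / 2) • (ψ ω - M)‖ - 1 - ‖(s / 2) • (ψ ω - M)‖) P :=
    hbi.mono' ((hdem.sub stronglyMeasurable_const).sub hdm.norm).aestronglyMeasurable
      (Eventually.of_forall fun ω => by rw [Real.norm_of_nonneg (hg0 _)]; exact hpt ω)
  refine ⟨((hgdi.add hdi.norm).add (integrable_const (1 : ℝ))).congr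
    (Eventually.of_forall fun ω => by simp only [Pi.add_apply]; ring), ?_⟩
  refine (integral_mono hgdi hbi hpt).trans ?_
  rw [integral_div, integral_add hgi (integrable_const _)]
  simp only [integral_const, probReal_univ, smul_eq_mul, one_mul]
  linarith

/-- Bernstein's inequality for averages of independent random vectors. -/
theorem BernsteinMoments.measure_pi_le [InnerProductSpace ℝ E] [CompleteSpace E]
    [IsProbabilityMeasure P] {ψ : Ω → E} {v B : ℝ}
    (h : BernsteinMoments P ψ v B) (hψ : StronglyMeasurable ψ) (hv : 0 < v) (hB : 0 ≤ B)
    {τ : ℝ} (hτ : 0 < τ) {n : ℕ} (hn : 0 < n) :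
    Measure.pi (fun _ : Fin n => P)
      {D | 2 * (√(2 * v * τ / n) + B * τ / n) <
        ‖(1 / (n : ℝ)) • ∑ i, ψ (D i) - ∫ ω, ψ ω ∂P‖} ≤ ENNReal.ofReal (2 * Real.exp (-τ)) := by
  have hn' : (0 : ℝ) < n := Nat.cast_pos.2 hn
  -- `q` and `s = 1 / (B + q)` balance the exponent: `1 - sB = sq` makes the moment term `sτq`, and
  -- subtracting it from the threshold `s(2τq + Bτ)` leaves exactly `τ`.
  set q := √(n * v / (2 * τ)) with hq
  have hq0 : 0 < q := Real.sqrt_pos.2 (by positivity)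
  have hq2 : q ^ 2 = n * v / (2 * τ) := Real.sq_sqrt (by positivity)
  set s := (B + q)⁻¹ with hs
  have hBq : 0 < B + q := by positivity
  have hs0 : 0 < s := inv_pos.2 hBq
  have hsBq : s * (B + q) = 1 := inv_mul_cancel₀ hBq.ne'
  have hsB : s * B < 1 := by nlinarith [mul_pos hs0 hq0]
  have hψi := h.integrable hψ
  obtain ⟨hexp, hint⟩ := h.centered hψ hv.le hB hs0.le hsB
  set M := ∫ ω, ψ ω ∂P
  set d : Ω → E := fun ω => (s / 2) • (ψ ω - M)
  have hdm : StronglyMeasurable d := (hψ.sub stronglyMeasurable_const).const_smul _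
  have hmean : ∫ ω, d ω ∂P = 0 := by
    simp only [d]
    rw [integral_smul, integral_sub hψi (integrable_const M)]
    simp [M]
  have hsqrt : √(2 * v * τ / n) = 2 * τ * q / n := by
    rw [Real.sqrt_eq_iff_mul_self_eq (by positivity) (by positivity), div_mul_div_comm,
      show 2 * τ * q * (2 * τ * q) = 4 * τ ^ 2 * q ^ 2 by ring, hq2]
    field_simp
    ring
  have hsum : ∀ D : Fin n → Ω, ∑ i, d (D i) =
      (n * s / 2) • ((1 / (n : ℝ)) • ∑ i, ψ (D i) - M) := by
    intro D
    simp only [d]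
    rw [← Finset.smul_sum, Finset.sum_sub_distrib, smul_sub, smul_sub, smul_smul]
    simp only [Finset.sum_const, Finset.card_univ, Fintype.card_fin]
    rw [← Nat.cast_smul_eq_nsmul ℝ, smul_smul]
    congr 2 <;> field_simp
  have htail := measure_pi_lt_norm_sum_le hdm hexp hmean n (s * (2 * τ * q + B * τ))
  refine (measure_mono fun D hD => ?_).trans (htail.trans (ENNReal.ofReal_le_ofReal ?_))
  · simp only [Set.mem_ofPred_eq] at hD ⊢
    rw [hsum, norm_smul, Real.norm_of_nonneg (by positivity)]
    rw [hsqrt] at hD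
    calc s * (2 * τ * q + B * τ) = n * s / 2 * (2 * (2 * τ * q / n + B * τ / n)) := by field_simp
      _ < _ := mul_lt_mul_of_pos_left hD (by positivity)
  · have h1 : 1 - s * B = s * q := by linarith
    rw [h1] at hint
    have h2 : s ^ 2 * v / (2 * (s * q)) = s * τ * q / n := by
      have : v = q ^ 2 * (2 * τ) / n := by rw [hq2]; field_simp
      rw [this]; field_simp
    rw [h2] at hint
    have h3 : (n : ℝ) * ∫ ω, (Real.exp ‖d ω‖ - 1 - ‖d ω‖) ∂P ≤ s * τ * q := by
      calc _ ≤ (n : ℝ) * (s * τ * q / n) := mul_le_mul_of_nonneg_left hint hn'.le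
        _ = _ := by field_simp
    gcongr
    have h4 : s * (2 * τ * q + B * τ) - s * τ * q = τ := by
      linear_combination τ * hsBq
    linarith

end Bernstein

/-! ### Normal equations of regularized least squares. -/

section RegularizedLeastSquares

variable {H K : Type*} [NormedAddCommGroup H] [InnerProductSpace ℝ H]
  [NormedAddCommGroup K] [InnerProductSpace ℝ K]

/-- Lax–Milgram for the form `lam ⟪f, g⟫ + w ⟪J f, J g⟫`, whose coercivity comes from the first term
alone. -/
theorem exists_normal_equation [CompleteSpace H] [CompleteSpace K] (J : H →L[ℝ] K) (y : K) {lam w : ℝ}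
    (hlam : 0 < lam) (hw : 0 ≤ w) : ∃ f : H, ∀ g : H, lam * ⟪f, g⟫_ℝ = w * ⟪y - J f, J g⟫_ℝ := by
  let B : H →L[ℝ] H →L[ℝ] ℝ := lam • innerSL ℝ + w • (innerSL ℝ).bilinearComp J J
  have hB : ∀ f g, B f g = lam * ⟪f, g⟫_ℝ + w * ⟪J f, J g⟫_ℝ := fun f g => rfl
  have hc : IsCoercive B := ⟨lam, hlam, fun f => by
    rw [hB, mul_assoc, real_inner_self_eq_norm_mul_norm]
    exact le_add_of_nonneg_right (mul_nonneg hw real_inner_self_nonneg)⟩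
  refine ⟨hc.continuousLinearEquivOfBilin.symm (w • J.adjoint y), fun g => ?_⟩
  set f := hc.continuousLinearEquivOfBilin.symm (w • J.adjoint y) with hf
  have h := hc.continuousLinearEquivOfBilin_apply f g
  rw [hf, ContinuousLinearEquiv.apply_symm_apply, ← hf, hB, real_inner_smul_left,
    ContinuousLinearMap.adjoint_inner_left] at h
  rw [inner_sub_left]
  linarith

theorem objective_add (J : H →L[ℝ] K) (y : K) (lam w : ℝ) (f g : H) :
    lam * ‖f + g‖ ^ 2 + w * ‖y - J (f + g)‖ ^ 2 =
      (lam * ‖f‖ ^ 2 + w * ‖y - J f‖ ^ 2) + 2 * (lam * ⟪f, g⟫_ℝ - w * ⟪y - J f, J g⟫_ℝ) +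
        (lam * ‖g‖ ^ 2 + w * ‖J g‖ ^ 2) := by
  rw [map_add, ← sub_sub, norm_add_sq_real, norm_sub_sq_real]
  ring

/-- The minimizer of a regularized least squares objective solves the normal equation. -/
theorem normal_equation_of_epsilon [CompleteSpace H] [CompleteSpace K] [Nonempty H]
    (J : H →L[ℝ] K) (y : K) {lam w : ℝ} (hlam : 0 < lam) (hw : 0 ≤ w) {F : H → ℝ}
    (hF : ∀ f, F f = lam * ‖f‖ ^ 2 + w * ‖y - J f‖ ^ 2) (g : H) :
    lam * ⟪Classical.epsilon fun f : H => IsMinOn F Set.univ f, g⟫_ℝ =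
      w * ⟪y - J (Classical.epsilon fun f : H => IsMinOn F Set.univ f), J g⟫_ℝ := by
  obtain ⟨f, hf⟩ := exists_normal_equation J y hlam hw
  have hadd : ∀ g, F (f + g) = F f + (lam * ‖g‖ ^ 2 + w * ‖J g‖ ^ 2) := fun g => by
    rw [hF, hF, objective_add, hf g]; ring
  have hmin : IsMinOn F Set.univ f := fun g _ => by
    have h := hadd (g - f)
    rw [add_sub_cancel] at h
    simp only [Set.mem_ofPred_eq]
    rw [h]
    have : 0 ≤ lam * ‖g - f‖ ^ 2 + w * ‖J (g - f)‖ ^ 2 := by positivity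
    linarith
  have hε := Classical.epsilon_spec (p := fun f : H => IsMinOn F Set.univ f) ⟨f, hmin⟩
  set f' := Classical.epsilon fun f : H => IsMinOn F Set.univ f
  -- Any minimizer is this one, as the objective grows by at least `lam ‖g‖²` away from `f`; hence
  -- the arbitrary choice made by `epsilon` does not matter.
  have heq : f' = f := by
    have h1 := hadd (f' - f)
    rw [add_sub_cancel] at h1
    have h2 : F f' ≤ F f := hε (Set.mem_univ f)
    have h3 : 0 ≤ w * ‖J (f' - f)‖ ^ 2 := by positivity
    have h4 : ‖f' - f‖ ^ 2 ≤ 0 := by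
      by_contra! h5
      nlinarith [mul_pos hlam h5]
    exact sub_eq_zero.1 (norm_eq_zero.1 (pow_eq_zero_iff two_ne_zero |>.1
      (le_antisymm h4 (sq_nonneg _))))
  rw [heq]
  exact hf g

variable {X : Type*} [CompleteSpace H] [RKHS ℝ H X ℝ]

theorem svmEmp_normal_equation {n : ℕ} (D : Fin n → X × ℝ) {lam : ℝ} (hlam : 0 < lam) (g : H) :
    lam * ⟪svmEmp H D lam, g⟫_ℝ =
      1 / (n : ℝ) * ∑ i, ((D i).2 - svmEmp H D lam (D i).1) * g (D i).1 := by
  let J : H →L[ℝ] EuclideanSpace ℝ (Fin n) :=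
    (EuclideanSpace.equiv (Fin n) ℝ).symm.toContinuousLinearMap ∘L
      ContinuousLinearMap.pi fun i => innerSL ℝ (feature H (D i).1)
  have hJ : ∀ f i, J f i = f (D i).1 := fun f i => by simp [J, inner_feature]
  let y : EuclideanSpace ℝ (Fin n) := WithLp.toLp 2 fun i => (D i).2
  -- For `n = 0` the weight is `1 / 0 = 0`, which a nonnegative `w` allows.
  have := normal_equation_of_epsilon J y hlam (w := 1 / (n : ℝ)) (by positivity)
    (F := fun f : H => lam * ‖f‖ ^ 2 + 1 / (n : ℝ) * ∑ i, ((D i).2 - f (D i).1) ^ 2)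
    (fun f => by simp [EuclideanSpace.real_norm_sq_eq, hJ, y]) g
  rw [PiLp.inner_apply] at this
  simpa [hJ, y, svmEmp, mul_comm] using this

theorem svmPop_normal_equation [MeasurableSpace X] (hk : BoundedMeasurableKernel H) (P : Measure (X × ℝ))
    [IsProbabilityMeasure P] (hP : Integrable (fun p : X × ℝ => p.2 ^ 2) P) {lam : ℝ}
    (hlam : 0 < lam) (g : H) :
    lam * ⟪svmPop H P lam, g⟫_ℝ = ∫ p, (p.2 - svmPop H P lam p.1) * g p.1 ∂P := by
  have hfst : MeasurePreserving (Prod.fst : X × ℝ → X) P P.fst := ⟨measurable_fst, rfl⟩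
  let J : H →L[ℝ] Lp ℝ 2 P :=
    (Lp.compMeasurePreservingₗᵢ ℝ Prod.fst hfst).toContinuousLinearMap ∘L embL2 hk P.fst
  have hJ : ∀ f : H, J f =ᵐ[P] fun p => f p.1 := fun f => by
    refine (Lp.coeFn_compMeasurePreserving (embL2 hk P.fst f) hfst).trans ?_
    exact hfst.quasiMeasurePreserving.ae_eq_comp (coeFn_embL2 hk P.fst f)
  have hy : MemLp (fun p : X × ℝ => p.2) 2 P :=
    (memLp_two_iff_integrable_sq measurable_snd.aestronglyMeasurable).2 hP
  have hsub : ∀ f : H, (hy.toLp _ - J f : Lp ℝ 2 P) =ᵐ[P] fun p => p.2 - f p.1 := fun f => by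
    filter_upwards [Lp.coeFn_sub (hy.toLp _) (J f), hy.coeFn_toLp, hJ f] with p h1 h2 h3
    rw [h1, Pi.sub_apply, h2, h3]
  have := normal_equation_of_epsilon J (hy.toLp _) hlam (w := 1) zero_le_one
    (F := fun f : H => lam * ‖f‖ ^ 2 + ∫ p, (p.2 - f p.1) ^ 2 ∂P) (fun f => by
      rw [one_mul, ← real_inner_self_eq_norm_sq (hy.toLp _ - J f), L2.inner_def]
      congr 1
      refine integral_congr_ae ?_
      filter_upwards [hsub f] with p hp
      rw [hp]; simp [sq]) g
  refine this.trans ?_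
  rw [one_mul, L2.inner_def]
  refine integral_congr_ae ?_
  filter_upwards [hsub (svmPop H P lam), hJ g] with p h1 h2
  simp only [svmPop] at h1 ⊢
  rw [h1, h2]
  simp [mul_comm]

end RegularizedLeastSquares

/-! ### Square-summable sequences and orthonormal series. -/

section SquareSummable

variable {ι : Type*}

theorem memlp_two_of_summable {f : ι → ℝ} (h : Summable fun i => f i ^ 2) : Memℓp f 2 :=
  memℓp_gen (by simpa using h)

theorem hasSum_sq_lp_two (a : lp (fun _ : ι => ℝ) 2) : HasSum (fun i => a i ^ 2) (‖a‖ ^ 2) := by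
  have := lp.hasSum_norm (p := 2) (by simp) a
  simpa using this

/-- Finite truncations are strongly measurable and converge pointwise in norm. -/
theorem stronglyMeasurable_lp_two [Countable ι] {Ω : Type*} [MeasurableSpace Ω]
    {f : Ω → lp (fun _ : ι => ℝ) 2} (hf : ∀ i, Measurable fun ω => f ω i) :
    StronglyMeasurable f := by
  classical
  refine stronglyMeasurable_of_tendsto (f := fun (s : Finset ι) ω =>
    ∑ i ∈ s, lp.single 2 i (f ω i)) atTop (fun s => ?_) (tendsto_pi_nhds.2 fun ω =>
      lp.hasSum_single (by simp) (f ω))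
  refine Finset.stronglyMeasurable_fun_sum _ fun i _ => ?_
  exact (lp.singleContinuousLinearMap ℝ (fun _ : ι => ℝ) 2 i).continuous.comp_stronglyMeasurable
    (hf i).stronglyMeasurable

end SquareSummable

/-- Weighted AM-GM with the weights dropped. It trades powers of `μᵢ` for powers of `lam` below,
both for `α` and for `γ`. -/
theorem rpow_mul_rpow_one_sub_le {a b t : ℝ} (ha : 0 ≤ a) (hb : 0 ≤ b) (ht : t ∈ Set.Icc (0 : ℝ) 1) :
    a ^ (1 - t) * b ^ t ≤ a + b := by
  refine (Real.geom_mean_le_arith_mean2_weighted (sub_nonneg.2 ht.2) ht.1 ha hb (by ring)).trans ?_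
  nlinarith [ht.1, ht.2]

/-- Orthogonal projection onto the closed span of an orthonormal family, as a series. -/
theorem exists_hasSum_inner_smul {ι H : Type*} [NormedAddCommGroup H] [InnerProductSpace ℝ H]
    [CompleteSpace H] {v : ι → H} (hv : Orthonormal ℝ v) (h : H) :
    ∃ p, HasSum (fun i => ⟪v i, h⟫_ℝ • v i) p ∧ ∀ j, ⟪v j, h - p⟫_ℝ = 0 := by
  classical
  have hs : Summable fun i => ⟪v i, h⟫_ℝ ^ 2 := by
    simpa using hv.inner_products_summable h
  have hsum := hv.orthogonalFamily.summable_of_lp ⟨_, memlp_two_of_summable hs⟩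
  obtain ⟨p, hp⟩ := hsum
  have hp' : HasSum (fun i => ⟪v i, h⟫_ℝ • v i) p := by simpa using hp
  refine ⟨p, hp', fun j => ?_⟩
  have h1 := hp'.mapL (innerSL ℝ (v j))
  have h2 : HasSum (fun i => innerSL ℝ (v j) (⟪v i, h⟫_ℝ • v i)) ⟪v j, h⟫_ℝ := by
    have h3 : ∀ i, innerSL ℝ (v j) (⟪v i, h⟫_ℝ • v i) = if i = j then ⟪v j, h⟫_ℝ else 0 := by
      intro i
      have := orthonormal_iff_ite.1 hv j i
      rw [map_smul, innerSL_apply_apply, this]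
      by_cases hij : j = i
      · subst hij; simp
      · simp [hij, Ne.symm hij]
    simp_rw [h3]
    exact hasSum_ite_eq j _
  have h4 := h1.unique h2
  rw [innerSL_apply_apply] at h4
  rw [inner_sub_right, h4, sub_self]

/-! ### Eigencoordinates, the preconditioned feature map and the power norm. -/

namespace SpectralSystem

variable {X H ι : Type*} [MeasurableSpace X] [NormedAddCommGroup H] [InnerProductSpace ℝ H]
  [CompleteSpace H] [RKHS ℝ H X ℝ] {hk : BoundedMeasurableKernel H} {ν : Measure X}
  [IsFiniteMeasure ν] (E : SpectralSystem hk ν ι)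

/-- The `i`-th Fourier coefficient with respect to the orthonormal eigenbasis in `H`. -/
def coef (h : H) (i : ι) : ℝ := ⟪√(E.eigval i) • E.eigfun i, h⟫_ℝ

theorem coef_feature (x : X) (i : ι) :
    E.coef (feature H x) i = √(E.eigval i) * E.eigfun i x := by
  rw [coef, real_inner_comm, real_inner_smul_right, inner_feature]

theorem summable_coef_sq (h : H) : Summable fun i => E.coef h i ^ 2 := by
  simpa [coef] using E.orthonormal_H.inner_products_summable h

theorem tsum_coef_sq_le (h : H) : ∑' i, E.coef h i ^ 2 ≤ ‖h‖ ^ 2 := by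
  simpa [coef] using E.orthonormal_H.tsum_inner_products_le h

theorem countable (E : SpectralSystem hk ν ι) : Countable ι := by
  have h := E.summable_eigval.countable_support
  have : Function.support E.eigval = Set.univ :=
    Set.eq_univ_of_forall fun i => (E.eigval_pos i).ne'
  rw [this] at h
  exact Set.countable_univ_iff.1 h

theorem norm_embL2_sq (hk : BoundedMeasurableKernel H) (ν : Measure X) [IsFiniteMeasure ν]
    (h : H) : ‖embL2 hk ν h‖ ^ 2 = ⟪h, opH hk ν h⟫_ℝ := by
  simp [opH, ContinuousLinearMap.adjoint_inner_right]

theorem hasSum_norm_embL2_sq (h : H) :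
    HasSum (fun i => E.eigval i * E.coef h i ^ 2) (‖embL2 hk ν h‖ ^ 2) := by
  rw [norm_embL2_sq]
  have := (E.hasSum_opH h).mapL (innerSL ℝ h)
  refine this.congr_fun fun i => ?_
  rw [innerSL_apply_apply, real_inner_smul_right, real_inner_comm h, coef, real_inner_comm h]
  ring

/-- Only the class of `h` vanishes: the eigenbasis need not span `H`, because `I_ν` may have a
kernel. -/
theorem embL2_eq_zero_of_coef {h : H} (h0 : ∀ i, E.coef h i = 0) : embL2 hk ν h = 0 := by
  have := E.hasSum_norm_embL2_sq h
  simp only [h0] at this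
  have h2 : ‖embL2 hk ν h‖ ^ 2 = 0 := this.unique (by simp)
  exact norm_eq_zero.1 (pow_eq_zero_iff two_ne_zero |>.1 h2)

theorem hasSum_embL2 (h : H) :
    HasSum (fun i => (E.coef h i * √(E.eigval i)) • embL2 hk ν (E.eigfun i)) (embL2 hk ν h) := by
  obtain ⟨p, hp, hp0⟩ := exists_hasSum_inner_smul E.orthonormal_H h
  have h1 : embL2 hk ν h = embL2 hk ν p := by
    rw [← sub_eq_zero, ← map_sub]; exact E.embL2_eq_zero_of_coef hp0
  rw [h1]
  refine (hp.mapL (embL2 hk ν)).congr_fun fun i => ?_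
  rw [map_smul, map_smul, smul_smul, coef]

/-- The series representation of the elements of `H` holds simultaneously at almost all points. -/
theorem ae_hasSum_coe [TopologicalSpace.SeparableSpace H] :
    ∀ᵐ x ∂ν, ∀ h : H, HasSum (fun i => E.coef (feature H x) i * E.coef h i) (h x) := by
  choose p hp hp0 using exists_hasSum_inner_smul E.orthonormal_H
  let d := TopologicalSpace.denseSeq H
  -- Separability enters here: one null set serves a countable dense sequence.
  have hae : ∀ᵐ x ∂ν, ∀ k : ℕ, (d k - p (d k)) x = 0 := by
    refine ae_all_iff.2 fun k => ?_
    have h1 := coeFn_embL2 hk ν (d k - p (d k))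
    rw [E.embL2_eq_zero_of_coef (hp0 (d k))] at h1
    filter_upwards [h1, Lp.coeFn_zero ℝ 2 ν] with x hx h0
    rw [← hx, h0]; rfl
  filter_upwards [hae] with x hx
  set k := feature H x with hkx
  have hperp : ∀ f g : H, ⟪g - p g, p f⟫_ℝ = 0 := fun f g => by
    have h1 := (hp f).mapL (innerSL ℝ (g - p g))
    have h2 : ∀ i, innerSL ℝ (g - p g) (⟪√(E.eigval i) • E.eigfun i, f⟫_ℝ •
        √(E.eigval i) • E.eigfun i) = 0 := fun i => by
      rw [map_smul, innerSL_apply_apply, real_inner_comm _ (g - p g), hp0, smul_zero]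
    simp only [h2] at h1
    exact h1.unique hasSum_zero
  -- At a good point, the part of the feature orthogonal to the eigenbasis is orthogonal to the
  -- dense sequence, so it vanishes. This frees the exceptional set from any dependence on `h`.
  have hzero : k - p k = 0 := by
    refine (TopologicalSpace.denseRange_denseSeq H).eq_zero_of_inner_left (𝕜 := ℝ) ?_
    intro m
    have h1 : ⟪k - p k, d m⟫_ℝ = ⟪k - p k, d m - p (d m)⟫_ℝ := by
      rw [inner_sub_right, hperp, sub_zero]
    have h2 : ⟪p k, d m - p (d m)⟫_ℝ = 0 := by rw [real_inner_comm]; exact hperp k (d m)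
    change ⟪k - p k, d m⟫_ℝ = 0
    rw [h1, inner_sub_left, h2, sub_zero, inner_feature, hx m]
  intro h
  rw [← inner_feature, ← hkx]
  have h3 := (hp k).mapL (innerSL ℝ h)
  rw [innerSL_apply_apply, ← sub_eq_zero.1 hzero, real_inner_comm] at h3
  refine h3.congr_fun fun i => ?_
  rw [innerSL_apply_apply, real_inner_smul_right, real_inner_comm _ h, coef, coef]

variable {lam : ℝ}

/-- The feature `k(·, x)` in eigencoordinates, preconditioned by `(I_ν^* I_ν + lam)^(-1/2)`. -/
def regFeature (hlam : 0 < lam) (x : X) : lp (fun _ : ι => ℝ) 2 :=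
  ⟨fun i => E.coef (feature H x) i / √(E.eigval i + lam), memlp_two_of_summable (by
    refine Summable.of_nonneg_of_le (fun i => sq_nonneg _) (fun i => ?_)
      ((E.summable_coef_sq (feature H x)).div_const lam)
    have := E.eigval_pos i
    rw [div_pow, Real.sq_sqrt (by linarith)]
    gcongr
    linarith)⟩

/-- The eigencoordinates of `(I_ν^* I_ν + lam)^(1/2) h`. -/
def regCoef (hlam : 0 < lam) (h : H) : lp (fun _ : ι => ℝ) 2 :=
  ⟨fun i => E.coef h i * √(E.eigval i + lam), memlp_two_of_summable (by
    refine ((E.hasSum_norm_embL2_sq h).summable.add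
      ((E.summable_coef_sq h).mul_left lam)).congr fun i => ?_
    have := E.eigval_pos i
    rw [mul_pow, Real.sq_sqrt (by linarith)]
    ring)⟩

theorem regFeature_apply (hlam : 0 < lam) (x : X) (i : ι) :
    E.regFeature hlam x i = E.coef (feature H x) i / √(E.eigval i + lam) := rfl

theorem regCoef_apply (hlam : 0 < lam) (h : H) (i : ι) :
    E.regCoef hlam h i = E.coef h i * √(E.eigval i + lam) := rfl

theorem regFeature_sq (hlam : 0 < lam) (x : X) (i : ι) :
    E.regFeature hlam x i ^ 2 = E.eigval i / (E.eigval i + lam) * E.eigfun i x ^ 2 := by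
  have := E.eigval_pos i
  rw [regFeature_apply, coef_feature, div_pow, mul_pow, Real.sq_sqrt this.le,
    Real.sq_sqrt (by linarith)]
  ring

theorem regCoef_sq (hlam : 0 < lam) (h : H) (i : ι) :
    E.regCoef hlam h i ^ 2 = E.coef h i ^ 2 * (E.eigval i + lam) := by
  have := E.eigval_pos i
  rw [regCoef_apply, mul_pow, Real.sq_sqrt (by linarith)]

/-- An inequality only, since the part of `h` in the kernel of `I_ν` counts in `‖h‖` but has no
coordinates. -/
theorem norm_regCoef_sq_le (hlam : 0 < lam) (h : H) :
    ‖E.regCoef hlam h‖ ^ 2 ≤ ‖embL2 hk ν h‖ ^ 2 + lam * ‖h‖ ^ 2 := by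
  have h1 := (E.hasSum_norm_embL2_sq h).add ((E.summable_coef_sq h).hasSum.mul_left lam)
  have h2 : ‖E.regCoef hlam h‖ ^ 2 = ‖embL2 hk ν h‖ ^ 2 + lam * ∑' i, E.coef h i ^ 2 := by
    refine (hasSum_sq_lp_two _).unique (h1.congr_fun fun i => ?_)
    rw [regCoef_sq]; ring
  rw [h2]
  gcongr
  exact E.tsum_coef_sq_le h

/-- The two weights cancel. The quantifier over `h` stands inside, as the identity is needed at the
sample points for an `h` that depends on the sample. -/
theorem ae_inner_regFeature [TopologicalSpace.SeparableSpace H] (hlam : 0 < lam) :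
    ∀ᵐ x ∂ν, ∀ h : H, ⟪E.regCoef hlam h, E.regFeature hlam x⟫_ℝ = h x := by
  filter_upwards [E.ae_hasSum_coe] with x hx h
  refine (lp.hasSum_inner _ _).unique ((hx h).congr_fun fun i => ?_)
  have := E.eigval_pos i
  have h0 : √(E.eigval i + lam) ≠ 0 := (Real.sqrt_pos.2 (by linarith)).ne'
  rw [regCoef_apply, regFeature_apply, real_inner_eq_re_inner]
  simp
  field_simp

theorem stronglyMeasurable_regFeature (hlam : 0 < lam) :
    StronglyMeasurable (E.regFeature hlam) := by
  have := E.countable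
  refine stronglyMeasurable_lp_two fun i => ?_
  simp only [regFeature_apply, coef_feature]
  exact ((hk.measurable_coe (E.eigfun i)).const_mul _).div_const _

theorem ofReal_norm_regFeature_sq (hlam : 0 < lam) (x : X) :
    ENNReal.ofReal (‖E.regFeature hlam x‖ ^ 2) =
      ∑' i, ENNReal.ofReal (E.eigval i / (E.eigval i + lam) * E.eigfun i x ^ 2) := by
  have h := hasSum_sq_lp_two (E.regFeature hlam x)
  rw [← h.tsum_eq, ENNReal.ofReal_tsum_of_nonneg (fun i => sq_nonneg _) h.summable]
  simp_rw [regFeature_sq]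

theorem summable_effDim (hlam : 0 < lam) :
    Summable fun i => E.eigval i / (E.eigval i + lam) := by
  refine Summable.of_nonneg_of_le (fun i => ?_) (fun i => ?_) (E.summable_eigval.div_const lam)
  · have := E.eigval_pos i
    positivity
  · have := E.eigval_pos i
    gcongr
    linarith

theorem effDim_nonneg (hlam : 0 < lam) : 0 ≤ E.effDim lam :=
  tsum_nonneg fun i => by have := E.eigval_pos i; positivity

theorem effDim_pos [Nonempty ι] (hlam : 0 < lam) : 0 < E.effDim lam := by
  obtain ⟨i⟩ := ‹Nonempty ι›
  exact (E.summable_effDim hlam).tsum_pos (fun i => by have := E.eigval_pos i; positivity) i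
    (by have := E.eigval_pos i; positivity)

/-- Each `[eᵢ]_ν` has norm one in `L₂(ν)`, so the series integrates term by term to the effective
dimension. -/
theorem lintegral_norm_regFeature_sq (hlam : 0 < lam) :
    ∫⁻ x, ENNReal.ofReal (‖E.regFeature hlam x‖ ^ 2) ∂ν = ENNReal.ofReal (E.effDim lam) := by
  have := E.countable
  have hnn : ∀ i, 0 ≤ E.eigval i / (E.eigval i + lam) := fun i => by
    have := E.eigval_pos i; positivity
  have hm : ∀ i, Measurable fun x => ENNReal.ofReal (E.eigfun i x ^ 2) := fun i =>
    ((hk.measurable_coe (E.eigfun i)).pow_const 2).ennreal_ofReal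
  simp_rw [ofReal_norm_regFeature_sq]
  rw [lintegral_tsum fun i => (((hk.measurable_coe (E.eigfun i)).pow_const 2).const_mul
    _).ennreal_ofReal.aemeasurable, effDim,
    ENNReal.ofReal_tsum_of_nonneg hnn (E.summable_effDim hlam)]
  refine tsum_congr fun i => ?_
  simp_rw [ENNReal.ofReal_mul (hnn i)]
  rw [lintegral_const_mul _ (hm i)]
  have h1 : ∫⁻ x, ENNReal.ofReal (E.eigfun i x ^ 2) ∂ν = 1 := by
    rw [← ofReal_integral_eq_lintegral_ofReal (hk.memLp_coe 2 ν (E.eigfun i)).integrable_sq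
      (Eventually.of_forall fun x => sq_nonneg _), ← ENNReal.ofReal_one]
    congr 1
    have h2 := E.orthonormal_L2.1 i
    have h3 : ‖embL2 hk ν (E.eigfun i)‖ ^ 2 = ∫ x, (E.eigfun i x) ^ 2 ∂ν := by
      rw [← real_inner_self_eq_norm_sq, L2.inner_def]
      refine integral_congr_ae ?_
      filter_upwards [coeFn_embL2 hk ν (E.eigfun i)] with x hx
      rw [hx]; simp [sq]
    rw [← h3, h2, one_pow]
  rw [h1, mul_one]

/-- The infimum is attained: a minimizing sequence involves only countably many null sets. -/
theorem ae_tsum_le_kernelPowerNorm (s : ℝ) : ∀ᵐ x ∂ν,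
    ∑' i, ENNReal.ofReal (E.eigval i ^ s * (E.eigfun i x) ^ 2) ≤ E.kernelPowerNorm s ^ 2 := by
  obtain ⟨u, -, hu, hmem⟩ := exists_seq_tendsto_sInf (S := {C : ℝ≥0∞ | ∀ᵐ x ∂ν,
    ∑' i, ENNReal.ofReal (E.eigval i ^ s * (E.eigfun i x) ^ 2) ≤ C ^ 2})
    ⟨⊤, by simp⟩ (OrderBot.bddBelow _)
  filter_upwards [ae_all_iff.2 hmem] with x hx
  exact ge_of_tendsto' (((ENNReal.continuous_pow 2).tendsto _).comp hu) hx

/-- Termwise `μ / (μ + lam) ≤ μ^α lam^(-α)`, which is `μ^(1-α) lam^α ≤ μ + lam`. -/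
theorem ae_norm_regFeature_sq_le (hlam : 0 < lam) {α : ℝ} (hα : α ∈ Set.Icc (0 : ℝ) 1)
    (hemb : E.kernelPowerNorm α < ∞) : ∀ᵐ x ∂ν,
      ‖E.regFeature hlam x‖ ^ 2 ≤ (E.kernelPowerNorm α).toReal ^ 2 * lam ^ (-α) := by
  filter_upwards [E.ae_tsum_le_kernelPowerNorm α] with x hx
  refine (ENNReal.ofReal_le_ofReal_iff (by positivity)).1 ?_
  rw [ofReal_norm_regFeature_sq, ENNReal.ofReal_mul (by positivity),
    ENNReal.ofReal_pow ENNReal.toReal_nonneg, ENNReal.ofReal_toReal hemb.ne]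
  refine le_trans ?_ (mul_le_mul_left hx _)
  rw [← ENNReal.tsum_mul_right]
  refine ENNReal.tsum_le_tsum fun i => ?_
  have hμ := E.eigval_pos i
  rw [← ENNReal.ofReal_mul (by positivity), mul_right_comm]
  refine ENNReal.ofReal_le_ofReal (mul_le_mul_of_nonneg_right ?_ (sq_nonneg _))
  rw [div_le_iff₀ (by linarith)]
  have h1 := rpow_mul_rpow_one_sub_le hμ.le hlam.le hα
  have h2 : E.eigval i ^ α * lam ^ (-α) * (E.eigval i ^ (1 - α) * lam ^ α) = E.eigval i := by
    rw [mul_mul_mul_comm, ← Real.rpow_add hμ, ← Real.rpow_add hlam]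
    simp
  calc E.eigval i = E.eigval i ^ α * lam ^ (-α) * (E.eigval i ^ (1 - α) * lam ^ α) := h2.symm
    _ ≤ _ := mul_le_mul_of_nonneg_left h1 (by positivity)

/-- The power norm is an infimum over expansions, so exhibiting one suffices: its coefficients are
`coef h i * μᵢ^((1-γ)/2)`, and `μ^(1-γ) lam^γ ≤ μ + lam` compares them with `regCoef`. -/
theorem powerNorm_embL2_sq_le (hlam : 0 < lam) {γ : ℝ} (hγ : γ ∈ Set.Icc (0 : ℝ) 1) (h : H) :
    E.powerNorm γ (embL2 hk ν h) ^ 2 ≤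
      ENNReal.ofReal (lam ^ (-γ) * ‖E.regCoef hlam h‖ ^ 2) := by
  have hle : ∀ i, (E.coef h i * E.eigval i ^ ((1 - γ) / 2)) ^ 2 ≤
      lam ^ (-γ) * E.regCoef hlam h i ^ 2 := fun i => by
    have hμ := E.eigval_pos i
    have h1 := rpow_mul_rpow_one_sub_le hμ.le hlam.le hγ
    have h2 : (E.eigval i ^ ((1 - γ) / 2)) ^ 2 = E.eigval i ^ (1 - γ) := by
      rw [← Real.rpow_natCast, ← Real.rpow_mul hμ.le]; congr 1; push_cast; ring
    rw [regCoef_sq, mul_pow, h2, mul_left_comm]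
    refine mul_le_mul_of_nonneg_left ?_ (sq_nonneg _)
    calc E.eigval i ^ (1 - γ) = lam ^ (-γ) * (E.eigval i ^ (1 - γ) * lam ^ γ) := by
          rw [mul_left_comm, ← Real.rpow_add hlam]; simp
      _ ≤ _ := mul_le_mul_of_nonneg_left h1 (by positivity)
  have hS := (hasSum_sq_lp_two (E.regCoef hlam h)).mul_left (lam ^ (-γ))
  let a : lp (fun _ : ι => ℝ) 2 := ⟨fun i => E.coef h i * E.eigval i ^ ((1 - γ) / 2),
    memlp_two_of_summable (Summable.of_nonneg_of_le (fun i => sq_nonneg _) hle hS.summable)⟩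
  have ha : E.IsExpansion γ a (embL2 hk ν h) := by
    refine (E.hasSum_embL2 h).congr_fun fun i => ?_
    have hμ := E.eigval_pos i
    change (E.coef h i * E.eigval i ^ ((1 - γ) / 2) * E.eigval i ^ (γ / 2)) • _ = _
    rw [mul_assoc, ← Real.rpow_add hμ, Real.sqrt_eq_rpow]
    congr 3; ring
  have hn : ‖a‖ ^ 2 ≤ lam ^ (-γ) * ‖E.regCoef hlam h‖ ^ 2 :=
    hasSum_le hle (hasSum_sq_lp_two a) hS
  calc E.powerNorm γ (embL2 hk ν h) ^ 2 ≤ ENNReal.ofReal ‖a‖ ^ 2 := by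
        gcongr
        exact iInf₂_le a ha
    _ = ENNReal.ofReal (‖a‖ ^ 2) := (ENNReal.ofReal_pow (norm_nonneg _) 2).symm
    _ ≤ _ := ENNReal.ofReal_le_ofReal hn

end SpectralSystem

/-! ### Rank-one operators as vectors. -/

section TensorSquare

open scoped TensorProduct

variable {F : Type*} [NormedAddCommGroup F] [InnerProductSpace ℝ F]

/-- The tensor square `u ⊗ u` in the Hilbert space tensor product. -/
def tensorSq (u : F) : UniformSpace.Completion (F ⊗[ℝ] F) := ((u ⊗ₜ[ℝ] u : F ⊗[ℝ] F) :)

/-- Quadratic expressions `h(x)² = ⟪u, φ(x)⟫²` become linear in `φ(x) ⊗ φ(x)`, so sums and integrals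
pass through the inner product. -/
theorem inner_tensorSq (u v : F) : ⟪tensorSq u, tensorSq v⟫_ℝ = ⟪u, v⟫_ℝ ^ 2 := by
  rw [tensorSq, tensorSq, UniformSpace.Completion.inner_coe, TensorProduct.inner_tmul, sq]

theorem norm_tensorSq (u : F) : ‖tensorSq u‖ = ‖u‖ ^ 2 := by
  rw [tensorSq, UniformSpace.Completion.norm_coe, TensorProduct.norm_tmul, sq]

theorem continuous_tensorSq : Continuous (tensorSq : F → _) :=
  (UniformSpace.Completion.continuous_coe _).comp
    (TensorProduct.continuous_tmul.comp (continuous_id.prodMk continuous_id))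

end TensorSquare

theorem two_le_factorial {m : ℕ} (hm : 2 ≤ m) : (2 : ℝ) ≤ (m.factorial : ℝ) := by
  exact_mod_cast Nat.factorial_le hm

theorem lintegral_fst {X Y : Type*} [MeasurableSpace X] [MeasurableSpace Y] (P : Measure (X × Y))
    {f : X → ℝ≥0∞} (hf : Measurable f) : ∫⁻ p, f p.1 ∂P = ∫⁻ x, f x ∂P.fst :=
  (lintegral_map hf measurable_fst).symm

/-! ### Moment bounds for the covariance and residual vectors. -/

section Moments

variable {X F : Type*} [MeasurableSpace X] [NormedAddCommGroup F]
  {P : Measure (X × ℝ)} {φ : X → F} {A N : ℝ}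

/-- All but two of the `2m` factors `‖φ‖` are bounded by `A`, the last two integrate to `N`, and `m!
≥ 2` absorbs the factor `1/2`. -/
theorem bernsteinMoments_tensorSq [InnerProductSpace ℝ F] (hφ : StronglyMeasurable φ) (hN : 0 ≤ N)
    (hA : 0 ≤ A)
    (hφN : ∫⁻ x, ENNReal.ofReal (‖φ x‖ ^ 2) ∂P.fst = ENNReal.ofReal N)
    (hφA : ∀ᵐ x ∂P.fst, ‖φ x‖ ≤ A) :
    BernsteinMoments P (fun p => tensorSq (φ p.1)) (A ^ 2 * N) (A ^ 2) := by
  intro m hm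
  obtain ⟨k, rfl⟩ := Nat.exists_eq_add_of_le' hm
  simp only [norm_tensorSq, Nat.add_sub_cancel]
  have hmeas : ∀ j : ℕ, Measurable fun x => ENNReal.ofReal (‖φ x‖ ^ j) := fun j =>
    (hφ.norm.measurable.pow_const j).ennreal_ofReal
  simp only [← pow_mul]
  rw [lintegral_fst P (hmeas _)]
  calc ∫⁻ x, ENNReal.ofReal (‖φ x‖ ^ (2 * (k + 2))) ∂P.fst
      ≤ ∫⁻ x, ENNReal.ofReal (A ^ (2 * (k + 1))) * ENNReal.ofReal (‖φ x‖ ^ 2) ∂P.fst := by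
        refine lintegral_mono_ae ?_
        filter_upwards [hφA] with x hx
        rw [← ENNReal.ofReal_mul (by positivity)]
        refine ENNReal.ofReal_le_ofReal ?_
        rw [show 2 * (k + 2) = 2 * (k + 1) + 2 by ring, pow_add]
        gcongr
    _ = ENNReal.ofReal (A ^ (2 * (k + 1)) * N) := by
        rw [lintegral_const_mul _ (hmeas 2), hφN, ENNReal.ofReal_mul (by positivity)]
    _ ≤ _ := by
        refine ENNReal.ofReal_le_ofReal ?_
        have h2 := two_le_factorial (show 2 ≤ k + 2 by omega)
        have h3 : 0 ≤ A ^ (2 * (k + 1)) * N := by positivity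
        have h4 : A ^ 2 * N * A ^ (2 * k) = A ^ (2 * (k + 1)) * N := by ring
        rw [mul_assoc (1 / 2 * _), h4]
        nlinarith

/-- Moments of the residual `y - f(x)` given `x`. -/
theorem MomentCondition.residual [IsProbabilityMeasure P] {L R D : ℝ} (hL : 0 < L) (hR : 0 < R)
    (hmom : MomentCondition P L R) (hD : 0 ≤ D) {f : X → ℝ}
    (hf : ∀ᵐ x ∂P.fst, |condMean P x - f x| ≤ D) :
    ∀ᵐ x ∂P.fst, ∀ m : ℕ, 2 ≤ m →
      ∫⁻ y, ENNReal.ofReal (|y - f x| ^ m) ∂(P.condKernel x) ≤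
        ENNReal.ofReal (1 / 2 * (m.factorial : ℝ) * (4 * max L D ^ 2) * (2 * max R D) ^ (m - 2)) := by
  filter_upwards [hmom, hf] with x hx hfx m hm
  have hmeas : Measurable fun y : ℝ => ENNReal.ofReal (|y - condMean P x| ^ m) := by fun_prop
  calc ∫⁻ y, ENNReal.ofReal (|y - f x| ^ m) ∂(P.condKernel x)
      ≤ ∫⁻ y, (ENNReal.ofReal (2 ^ (m - 1)) * ENNReal.ofReal (|y - condMean P x| ^ m) +
          ENNReal.ofReal (2 ^ (m - 1) * D ^ m)) ∂(P.condKernel x) := by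
        refine lintegral_mono fun y => ?_
        rw [← ENNReal.ofReal_mul (by positivity), ← ENNReal.ofReal_add (by positivity)
          (by positivity), ← mul_add]
        refine ENNReal.ofReal_le_ofReal ?_
        have h1 : |y - f x| ≤ |y - condMean P x| + D :=
          (abs_sub_le y (condMean P x) (f x)).trans (by gcongr)
        -- The factor `2^(m-1) = (1/2) * 4 * 2^(m-2)` accounts for the constants `4` and `2` in the
        -- variance and scale.
        exact (pow_le_pow_left₀ (abs_nonneg _) h1 m).trans (add_pow_le (abs_nonneg _) hD m)
    _ = ENNReal.ofReal (2 ^ (m - 1)) *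
          ∫⁻ y, ENNReal.ofReal (|y - condMean P x| ^ m) ∂(P.condKernel x) +
          ENNReal.ofReal (2 ^ (m - 1) * D ^ m) := by
        rw [lintegral_add_right _ measurable_const, lintegral_const_mul _ hmeas, lintegral_const,
          measure_univ, mul_one]
    _ ≤ ENNReal.ofReal (2 ^ (m - 1)) *
          ENNReal.ofReal (1 / 2 * (m.factorial : ℝ) * L ^ 2 * R ^ (m - 2)) +
          ENNReal.ofReal (2 ^ (m - 1) * D ^ m) := by
        gcongr
        exact hx m hm
    _ ≤ _ := by
        rw [← ENNReal.ofReal_mul (by positivity), ← ENNReal.ofReal_add (by positivity)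
          (by positivity), ← mul_add]
        refine ENNReal.ofReal_le_ofReal ?_
        obtain ⟨k, rfl⟩ := Nat.exists_eq_add_of_le' hm
        have h2 := two_le_factorial hm
        simp only [Nat.add_sub_cancel, show k + 2 - 1 = k + 1 by omega]
        set q := max L D ^ 2 * max R D ^ k
        have hq : 0 ≤ q := by positivity
        have h3 : L ^ 2 * R ^ k ≤ q := by
          exact mul_le_mul (pow_le_pow_left₀ hL.le (le_max_left _ _) 2)
            (pow_le_pow_left₀ hR.le (le_max_left _ _) k) (by positivity) (by positivity)
        have h4 : D ^ (k + 2) ≤ q := by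
          rw [pow_add, mul_comm]
          exact mul_le_mul (pow_le_pow_left₀ hD (le_max_right _ _) 2)
            (pow_le_pow_left₀ hD (le_max_right _ _) k) (by positivity) (by positivity)
        have h5 : 1 / 2 * ((k + 2).factorial : ℝ) * L ^ 2 * R ^ k + D ^ (k + 2) ≤
            ((k + 2).factorial : ℝ) * q := by
          have : 1 / 2 * ((k + 2).factorial : ℝ) * (L ^ 2 * R ^ k) ≤
            1 / 2 * ((k + 2).factorial : ℝ) * q := by gcongr
          nlinarith
        calc _ ≤ 2 ^ (k + 1) * (((k + 2).factorial : ℝ) * q) := by gcongr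
          _ = _ := by rw [mul_pow, pow_succ]; simp only [q]; ring

/-- Given `x` the feature is constant, so the conditional moments apply first; then `m - 2` factors
`‖φ‖` are bounded by `A` and two integrate to `N`. -/
theorem bernsteinMoments_residual [IsProbabilityMeasure P] [NormedSpace ℝ F] (hφ : StronglyMeasurable φ)
    (hA : 0 ≤ A)
    (hφN : ∫⁻ x, ENNReal.ofReal (‖φ x‖ ^ 2) ∂P.fst = ENNReal.ofReal N)
    (hφA : ∀ᵐ x ∂P.fst, ‖φ x‖ ≤ A) {f : X → ℝ} (hf : Measurable f) {v B : ℝ} (hv : 0 ≤ v)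
    (hB : 0 ≤ B)
    (hres : ∀ᵐ x ∂P.fst, ∀ m : ℕ, 2 ≤ m →
      ∫⁻ y, ENNReal.ofReal (|y - f x| ^ m) ∂(P.condKernel x) ≤
        ENNReal.ofReal (1 / 2 * (m.factorial : ℝ) * v * B ^ (m - 2))) :
    BernsteinMoments P (fun p => (p.2 - f p.1) • φ p.1) (N * v) (A * B) := by
  intro m hm
  have hmeas : ∀ j : ℕ, Measurable fun x => ENNReal.ofReal (‖φ x‖ ^ j) := fun j =>
    (hφ.norm.measurable.pow_const j).ennreal_ofReal
  have hfm : Measurable fun p : X × ℝ => ENNReal.ofReal (|p.2 - f p.1| ^ m) := by fun_prop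
  have hsplit : ∀ p : X × ℝ, ENNReal.ofReal (‖(p.2 - f p.1) • φ p.1‖ ^ m) =
      ENNReal.ofReal (‖φ p.1‖ ^ m) * ENNReal.ofReal (|p.2 - f p.1| ^ m) := fun p => by
    rw [norm_smul, mul_pow, Real.norm_eq_abs, mul_comm, ENNReal.ofReal_mul (by positivity)]
  simp_rw [hsplit]
  have hprod : Measurable fun p : X × ℝ =>
      ENNReal.ofReal (‖φ p.1‖ ^ m) * ENNReal.ofReal (|p.2 - f p.1| ^ m) :=
    ((hmeas m).comp measurable_fst).mul hfm
  rw [← Measure.lintegral_condKernel hprod]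
  set C := 1 / 2 * (m.factorial : ℝ) * v * B ^ (m - 2)
  have hC : 0 ≤ C := by positivity
  calc ∫⁻ x, ∫⁻ y, ENNReal.ofReal (‖φ x‖ ^ m) * ENNReal.ofReal (|y - f x| ^ m)
        ∂(P.condKernel x) ∂P.fst
      ≤ ∫⁻ x, ENNReal.ofReal (A ^ (m - 2) * C) * ENNReal.ofReal (‖φ x‖ ^ 2) ∂P.fst := by
        refine lintegral_mono_ae ?_
        filter_upwards [hφA, hres] with x hx hrx
        rw [lintegral_const_mul' _ _ ENNReal.ofReal_ne_top]
        refine (mul_le_mul_right (hrx m hm) _).trans ?_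
        rw [← ENNReal.ofReal_mul (by positivity), ← ENNReal.ofReal_mul (by positivity)]
        refine ENNReal.ofReal_le_ofReal ?_
        have h1 : ‖φ x‖ ^ m = ‖φ x‖ ^ (m - 2) * ‖φ x‖ ^ 2 := by
          rw [← pow_add]; congr 1; omega
        rw [h1, mul_right_comm]
        gcongr
    _ = ENNReal.ofReal (A ^ (m - 2) * C * N) := by
        rw [lintegral_const_mul _ (hmeas 2), hφN, ← ENNReal.ofReal_mul (by positivity)]
    _ = _ := by
        congr 1
        simp only [C]
        rw [mul_pow]
        ring

end Moments

theorem ae_pi_of_ae {Ω : Type*} [MeasurableSpace Ω] {P : Measure Ω} [IsProbabilityMeasure P]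
    {p : Ω → Prop} (h : ∀ᵐ ω ∂P, p ω) (n : ℕ) :
    ∀ᵐ D ∂Measure.pi (fun _ : Fin n => P), ∀ i, p (D i) :=
  ae_all_iff.2 fun i =>
    (measurePreserving_eval (fun _ : Fin n => P) i).quasiMeasurePreserving.ae h

/-! ### The deterministic error bound. -/

namespace SpectralSystem

variable {X H ι : Type*} [MeasurableSpace X] [NormedAddCommGroup H] [InnerProductSpace ℝ H]
  [CompleteSpace H] [RKHS ℝ H X ℝ] {hk : BoundedMeasurableKernel H} {P : Measure (X × ℝ)}
  [IsProbabilityMeasure P] (E : SpectralSystem hk P.fst ι) {lam : ℝ}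

/-- The deviation of the empirical from the population residual vector. -/
def residualDev (hlam : 0 < lam) {n : ℕ} (D : Fin n → X × ℝ) : lp (fun _ : ι => ℝ) 2 :=
  (1 / (n : ℝ)) • ∑ i, ((D i).2 - svmPop H P lam (D i).1) • E.regFeature hlam (D i).1 -
    ∫ p, (p.2 - svmPop H P lam p.1) • E.regFeature hlam p.1 ∂P

open scoped TensorProduct in
/-- The deviation of the empirical from the population covariance. -/
def covarianceDev (hlam : 0 < lam) {n : ℕ} (D : Fin n → X × ℝ) :
    UniformSpace.Completion (lp (fun _ : ι => ℝ) 2 ⊗[ℝ] lp (fun _ : ι => ℝ) 2) :=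
  (1 / (n : ℝ)) • ∑ i, tensorSq (E.regFeature hlam (D i).1) -
    ∫ p, tensorSq (E.regFeature hlam p.1) ∂P

theorem integral_coe_sq (hk : BoundedMeasurableKernel H) (P : Measure (X × ℝ))
    [IsProbabilityMeasure P] (h : H) :
    ∫ p, h p.1 ^ 2 ∂P = ‖embL2 hk P.fst h‖ ^ 2 := by
  have h1 : ∫ p, h p.1 ^ 2 ∂P = ∫ x, h x ^ 2 ∂P.fst :=
    (integral_map measurable_fst.aemeasurable
      ((hk.measurable_coe h).pow_const 2).aestronglyMeasurable).symm
  rw [h1, ← real_inner_self_eq_norm_sq, L2.inner_def]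
  refine integral_congr_ae ?_
  filter_upwards [coeFn_embL2 hk P.fst h] with x hx
  rw [hx]; simp [sq]

/-- The estimation error is controlled by the two deviations. -/
theorem norm_regCoef_le [TopologicalSpace.SeparableSpace H]
    (hP : Integrable (fun p : X × ℝ => p.2 ^ 2) P) (hlam : 0 < lam) {n : ℕ} (D : Fin n → X × ℝ)
    (hD : ∀ i, ∀ h : H, ⟪E.regCoef hlam h, E.regFeature hlam (D i).1⟫_ℝ = h (D i).1)
    (hZ : Integrable (fun p => (p.2 - svmPop H P lam p.1) • E.regFeature hlam p.1) P)
    (hW : Integrable (fun p => tensorSq (E.regFeature hlam p.1)) P)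
    (hdev : ‖E.covarianceDev hlam D‖ ≤ 1 / 2) :
    ‖E.regCoef hlam (svmEmp H D lam - svmPop H P lam)‖ ≤ 2 * ‖E.residualDev hlam D‖ := by
  set h := svmEmp H D lam - svmPop H P lam with hh
  set u := E.regCoef hlam h with hu
  have hae : ∀ᵐ p ∂P, ⟪u, E.regFeature hlam p.1⟫_ℝ = h p.1 :=
    (⟨measurable_fst, rfl⟩ : MeasurePreserving Prod.fst P P.fst).quasiMeasurePreserving.ae
      ((E.ae_inner_regFeature hlam).mono fun x hx => hx h)
  have hcov : ⟪tensorSq u, E.covarianceDev hlam D⟫_ℝ =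
      1 / (n : ℝ) * ∑ i, h (D i).1 ^ 2 - ‖embL2 hk P.fst h‖ ^ 2 := by
    rw [covarianceDev, inner_sub_right, real_inner_smul_right, inner_sum, ← integral_inner hW,
      ← integral_coe_sq hk P h]
    simp_rw [inner_tensorSq]
    congr 1
    · congr 1
      exact Finset.sum_congr rfl fun i _ => by rw [hu, hD i h]
    · refine integral_congr_ae ?_
      filter_upwards [hae] with p hp
      rw [hp]
  have hres : ⟪u, E.residualDev hlam D⟫_ℝ =
      1 / (n : ℝ) * ∑ i, ((D i).2 - svmPop H P lam (D i).1) * h (D i).1 -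
        lam * ⟪svmPop H P lam, h⟫_ℝ := by
    rw [residualDev, inner_sub_right, real_inner_smul_right, inner_sum, ← integral_inner hZ,
      svmPop_normal_equation hk P hP hlam h]
    simp_rw [real_inner_smul_right]
    congr 1
    · congr 1
      exact Finset.sum_congr rfl fun i _ => by rw [hu, hD i h]
    · refine integral_congr_ae ?_
      filter_upwards [hae] with p hp
      rw [hp]
  have hemp := svmEmp_normal_equation D hlam h
  have hsplit : ∑ i, ((D i).2 - svmEmp H D lam (D i).1) * h (D i).1 =
      ∑ i, ((D i).2 - svmPop H P lam (D i).1) * h (D i).1 - ∑ i, h (D i).1 ^ 2 := by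
    rw [← Finset.sum_sub_distrib]
    refine Finset.sum_congr rfl fun i _ => ?_
    have : h (D i).1 = svmEmp H D lam (D i).1 - svmPop H P lam (D i).1 := by
      rw [hh]; simp
    rw [this]; ring
  have hnorm : lam * ‖h‖ ^ 2 = lam * ⟪svmEmp H D lam, h⟫_ℝ - lam * ⟪svmPop H P lam, h⟫_ℝ := by
    rw [← mul_sub, ← inner_sub_left, ← hh, real_inner_self_eq_norm_sq]
  -- Replacing the empirical residual by the population one costs the empirical mean of `h²`; `W`
  -- compares this with `‖I_ν h‖²`.
  have hid : lam * ‖h‖ ^ 2 + ‖embL2 hk P.fst h‖ ^ 2 =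
      ⟪u, E.residualDev hlam D⟫_ℝ - ⟪tensorSq u, E.covarianceDev hlam D⟫_ℝ := by
    rw [hnorm, hemp, hsplit, hres, hcov]; ring
  have h1 := E.norm_regCoef_sq_le hlam h
  have h2 : ⟪u, E.residualDev hlam D⟫_ℝ ≤ ‖u‖ * ‖E.residualDev hlam D‖ := real_inner_le_norm _ _
  have h3 : -⟪tensorSq u, E.covarianceDev hlam D⟫_ℝ ≤ ‖u‖ ^ 2 * (1 / 2) := by
    refine (neg_le_abs _).trans ((abs_real_inner_le_norm _ _).trans ?_)
    rw [norm_tensorSq]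
    gcongr
  rw [← hu] at h1
  -- What is left is `‖u‖² ≤ ‖u‖ ‖Z‖ + ‖u‖² / 2`; the negation makes `‖u‖` positive, so it can be
  -- cancelled.
  by_contra! hlt
  have hpos : 0 < ‖u‖ := (by positivity : 0 ≤ 2 * ‖E.residualDev hlam D‖).trans_lt hlt
  nlinarith

end SpectralSystem

/-- The two sample size conditions bound the root by `1/8` and the linear term by `1/16`, for a
total of `3/8`. -/
theorem covariance_threshold_le {A2 N τ n : ℝ} (hn : 0 < n) (hτ : 1 ≤ τ)
    (h1 : 256 * τ ^ 2 * A2 * N ≤ n) (h2 : 16 * τ * A2 ≤ n) :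
    2 * (√(2 * (A2 * N) * τ / n) + A2 * τ / n) ≤ 1 / 2 := by
  have h3 : √(2 * (A2 * N) * τ / n) ≤ 1 / 8 := by
    refine Real.sqrt_le_iff.2 ⟨by norm_num, ?_⟩
    rw [div_le_iff₀ hn]
    rcases le_or_gt (A2 * N) 0 with h | h
    · nlinarith [mul_nonneg (neg_nonneg.2 h) (by linarith : 0 ≤ τ)]
    · have : τ * (A2 * N) ≤ τ ^ 2 * (A2 * N) := by gcongr; nlinarith
      nlinarith
  have h4 : A2 * τ / n ≤ 1 / 16 := by
    rw [div_le_iff₀ hn]; linarith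
  linarith

/-- From `(4(a + b))² ≤ 32a² + 32b²`: the second term gives exactly the constant `128`, and the
first gives `256`, within `128 * 5`. -/
theorem residual_threshold_sq_le {A N L R τ n : ℝ} (hn : 0 < n) (hτ : 1 ≤ τ) (hN : 0 ≤ N) :
    (2 * (2 * (√(2 * (N * (4 * L ^ 2)) * τ / n) + A * (2 * R) * τ / n))) ^ 2 ≤
      128 * (τ ^ 2 / n) * (5 * N * L ^ 2 + A ^ 2 * (R ^ 2 / n)) := by
  have ha : √(2 * (N * (4 * L ^ 2)) * τ / n) ^ 2 = 2 * (N * (4 * L ^ 2)) * τ / n :=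
    Real.sq_sqrt (by positivity)
  set a := √(2 * (N * (4 * L ^ 2)) * τ / n)
  set b := A * (2 * R) * τ / n with hb
  have h1 : (2 * (2 * (a + b))) ^ 2 ≤ 32 * a ^ 2 + 32 * b ^ 2 := by
    nlinarith [sq_nonneg (a - b)]
  have h2 : 32 * b ^ 2 = 128 * (τ ^ 2 / n) * (A ^ 2 * (R ^ 2 / n)) := by
    rw [hb]; field_simp; ring
  have h3 : 32 * a ^ 2 ≤ 128 * (τ ^ 2 / n) * (5 * N * L ^ 2) := by
    rw [ha]
    have h4 : N * L ^ 2 * τ ≤ N * L ^ 2 * τ ^ 2 := by gcongr; nlinarith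
    have h5 : 0 ≤ N * L ^ 2 * τ ^ 2 := by positivity
    calc 32 * (2 * (N * (4 * L ^ 2)) * τ / n) = 256 * (N * L ^ 2 * τ) / n := by ring
      _ ≤ 640 * (N * L ^ 2 * τ ^ 2) / n := by
          refine div_le_div_of_nonneg_right ?_ hn.le
          linarith
      _ = _ := by ring
  linarith

end KernelRegression

end

/-! ### Assembly of the oracle inequality. -/

open KernelRegression in
theorem mainTheorem4
    {X H ι : Type*} [MeasurableSpace X]
    [NormedAddCommGroup H] [InnerProductSpace ℝ H] [CompleteSpace H]
    [TopologicalSpace.SeparableSpace H] [RKHS ℝ H X ℝ]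
    (hk : BoundedMeasurableKernel H)
    (P : Measure (X × ℝ)) [IsProbabilityMeasure P]
    (hP : Integrable (fun p : X × ℝ => p.2 ^ 2) P)
    (E : SpectralSystem hk P.fst ι)
    (α γ : ℝ) (hα : α ∈ Set.Icc (0 : ℝ) 1) (hγ : γ ∈ Set.Icc (0 : ℝ) 1)
    (hbdd : MemLp (condMean P) ∞ P.fst)
    (hsource : (hbdd.mono_exponent le_top).toLp (condMean P) ∈ E.powerSpace γ)
    (hemb : E.kernelPowerNorm α < ∞)
    (L R : ℝ) (hL : 0 < L) (hR : 0 < R) (hmom : MomentCondition P L R)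
    (τ lam : ℝ) (hτ : 1 ≤ τ) (hlam : 0 < lam)
    (n : ℕ) (hn : E.sampleBound α τ lam ≤ n) :
    Measure.pi (fun _ : Fin n => P)
        {D : Fin n → X × ℝ |
          ¬ E.powerNorm γ (embL2 hk P.fst (svmEmp H D lam - svmPop H P lam)) ^ 2 ≤
            ENNReal.ofReal (128 * (τ ^ 2 / (n * lam ^ γ)) *
              (5 * E.effDim lam * max L (approxErrorSup H P lam) ^ 2 +
                (E.kernelPowerNorm α).toReal ^ 2 *
                  (max R (approxErrorSup H P lam) ^ 2 / (n * lam ^ α))))} ≤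
      ENNReal.ofReal (4 * Real.exp (-τ)) := by
  set K := (E.kernelPowerNorm α).toReal
  set N := E.effDim lam
  set L' := max L (approxErrorSup H P lam)
  set R' := max R (approxErrorSup H P lam)
  have hτ0 : 0 < τ := by linarith
  have hnb := max_le_iff.1 hn
  have hnb' := max_le_iff.1 hnb.1
  -- The third entry `τ` of the sample bound serves to exclude `n = 0`.
  have hnR : (0 : ℝ) < n := hτ0.trans_le hnb.2
  have hn0 : 0 < n := Nat.cast_pos.1 hnR
  have hN : 0 ≤ N := E.effDim_nonneg hlam
  set A := √(K ^ 2 * lam ^ (-α))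
  have hA2 : A ^ 2 = K ^ 2 * lam ^ (-α) := Real.sq_sqrt (by positivity)
  have hA : 0 ≤ A := Real.sqrt_nonneg _
  have hscale : lam ^ (-γ) * (128 * (τ ^ 2 / n) * (5 * N * L' ^ 2 + A ^ 2 * (R' ^ 2 / n))) =
      128 * (τ ^ 2 / (n * lam ^ γ)) * (5 * N * L' ^ 2 + K ^ 2 * (R' ^ 2 / (n * lam ^ α))) := by
    rw [hA2, Real.rpow_neg hlam.le, Real.rpow_neg hlam.le]
    have := Real.rpow_pos_of_pos hlam α
    have := Real.rpow_pos_of_pos hlam γ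
    field_simp
  rw [← hscale]
  -- Without eigenvalues the variance proxies vanish and Bernstein's inequality does not apply, but
  -- then the power norm of the error is zero.
  rcases isEmpty_or_nonempty ι with hι | hι
  · refine le_of_eq_of_le ?_ zero_le
    convert measure_empty (μ := Measure.pi fun _ : Fin n => P)
    refine Set.eq_empty_of_forall_notMem fun D hD => hD ?_
    refine (E.powerNorm_embL2_sq_le hlam hγ _).trans (ENNReal.ofReal_le_ofReal ?_)
    rw [Subsingleton.elim (E.regCoef hlam _) 0, norm_zero, zero_pow two_ne_zero, mul_zero]
    positivity
  have hNpos : 0 < N := E.effDim_pos hlam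
  have hφm := E.stronglyMeasurable_regFeature hlam
  have hφN := E.lintegral_norm_regFeature_sq hlam
  have hφA : ∀ᵐ x ∂P.fst, ‖E.regFeature hlam x‖ ≤ A := by
    filter_upwards [E.ae_norm_regFeature_sq_le hlam hα hemb] with x hx
    exact Real.le_sqrt_of_sq_le hx
  have hApos : 0 < A := by
    refine hA.lt_of_ne fun h0 => ?_
    have h1 : ∫⁻ x, ENNReal.ofReal (‖E.regFeature hlam x‖ ^ 2) ∂P.fst = ∫⁻ _, 0 ∂P.fst := by
      refine lintegral_congr_ae ?_
      filter_upwards [hφA] with x hx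
      rw [← h0] at hx
      simp [norm_le_zero_iff.1 hx]
    rw [hφN, lintegral_zero, ENNReal.ofReal_eq_zero] at h1
    exact hNpos.not_ge h1
  have hsup : ∀ᵐ x ∂P.fst, |condMean P x - svmPop H P lam x| ≤ approxErrorSup H P lam := by
    have hmem : MemLp (fun x => condMean P x - svmPop H P lam x) ∞ P.fst :=
      -- Boundedness of the conditional mean keeps the essential supremum finite, so `toReal` loses
      -- nothing.
      hbdd.sub (hk.memLp_coe ∞ P.fst (svmPop H P lam))
    filter_upwards [ae_le_eLpNormEssSup (f := fun x => condMean P x - svmPop H P lam x)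
      (μ := P.fst)] with x hx
    rw [← Real.norm_eq_abs, ← toReal_enorm, approxErrorSup]
    rw [← eLpNorm_exponent_top] at hx
    exact ENNReal.toReal_mono hmem.2.ne hx
  have hWm := bernsteinMoments_tensorSq (P := P) hφm hN hA hφN hφA
  have hZm := bernsteinMoments_residual (P := P) hφm hA hφN hφA
    (hk.measurable_coe (svmPop H P lam)) (by positivity) (by positivity)
    (hmom.residual hL hR ENNReal.toReal_nonneg hsup)
  have hWs : StronglyMeasurable fun p : X × ℝ => tensorSq (E.regFeature hlam p.1) :=
    continuous_tensorSq.comp_stronglyMeasurable (hφm.comp_measurable measurable_fst)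
  have hZs : StronglyMeasurable fun p : X × ℝ =>
      (p.2 - svmPop H P lam p.1) • E.regFeature hlam p.1 :=
    ((measurable_snd.sub ((hk.measurable_coe (svmPop H P lam)).comp
      measurable_fst)).stronglyMeasurable).smul (hφm.comp_measurable measurable_fst)
  have hW := hWm.measure_pi_le hWs (by positivity) (by positivity) hτ0 hn0
  have hZ := hZm.measure_pi_le hZs (by positivity) (by positivity) hτ0 hn0
  have hae := ae_pi_of_ae (P := P) ((⟨measurable_fst, rfl⟩ : MeasurePreserving Prod.fst P
    P.fst).quasiMeasurePreserving.ae (E.ae_inner_regFeature hlam)) n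
  have hexp : ENNReal.ofReal (4 * Real.exp (-τ)) =
      ENNReal.ofReal (2 * Real.exp (-τ)) + ENNReal.ofReal (2 * Real.exp (-τ)) := by
    rw [← ENNReal.ofReal_add (by positivity) (by positivity)]; congr 1; ring
  rw [hexp]
  refine le_trans ?_ (add_le_add hW hZ)
  -- Monotonicity and subadditivity hold for outer measure, so the failure set need not be
  -- measurable.
  refine (measure_mono_ae ?_).trans (measure_union_le _ _)
  filter_upwards [hae] with D hD hbad
  by_contra hgood
  obtain ⟨hgoodW, hgoodZ⟩ := not_or.1 hgood
  refine hbad ((E.powerNorm_embL2_sq_le hlam hγ _).trans (ENNReal.ofReal_le_ofReal ?_))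
  refine mul_le_mul_of_nonneg_left ?_ (by positivity)
  have hdev : ‖E.covarianceDev hlam D‖ ≤ 1 / 2 := by
    refine (not_lt.1 hgoodW).trans (covariance_threshold_le hnR hτ ?_ ?_)
    · rw [hA2]; linarith [hnb'.1]
    · rw [hA2]; linarith [hnb'.2]
  have hu := E.norm_regCoef_le hP hlam D hD (hZm.integrable hZs) (hWm.integrable hWs) hdev
  refine le_trans (pow_le_pow_left₀ (norm_nonneg _) (hu.trans ?_) 2)
    (residual_threshold_sq_le hnR hτ hN)
  exact mul_le_mul_of_nonneg_left (not_lt.1 hgoodZ) zero_le_two
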